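/- Let $\Lambda_{24}\subset W=\mathbb{R}^{24}$ be the Leech lattice, i.e. the set of vectors $\frac{1}{\sqrt8}(a_1,\dots,a_{24})$, $a_i\in\mathbb{Z}$, such that for some integer $m$ all $a_i\equiv m \pmod 2$, the word $\bigl((a_i-m)/2 \bmod 2\bigr)_i$ lies in the binary Golay code (in MOG coordinates, numbered column by column), and $\sum_i a_i\equiv 4m\pmod 8$. Its minimal norm (squared length) is $\mu=4$. Let $V\subset\mathbb{R}^{24}$ be the $22$-dimensional space of vectors whose first three coordinates are equal, $U=V^\perp$, and let $\pi_U,\pi_V$ be the orthogonal projections. The center density of a packing is the fraction of space covered by its (solid) spheres, divided by the volume of the unit ball. Then the following hold. 1. The section $L=\Lambda_{24}\cap V$, which is the laminated lattice $\Lambda_{22}$ in its standard coordinates, is a $22$-dimensional lattice of determinant $12$ and minimal norm $4$; the packing by spheres of radius $1$ around its points has center density $1/\sqrt{12}=0.2886\ldots$. 2. $K=\Lambda_{24}\cap U$ is isometric to $\sqrt2\,A_2$ and $M=\pi_U(\Lambda_{24})$ is isometric to $\frac1{\sqrt2}A_2^*$, by a common isometry, where $A_2=\{x\in\mathbb{Z}^3: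 x_1+x_2+x_3=0\}$ and $A_2^*$ is its dual lattice. 3. There are equilateral triangles with vertices in $M$ and squared side length $\beta=\frac13$; one has the vertices $(0,\dots,0)$, $\frac{2}{\sqrt8}(\frac23,-\frac13,-\frac13,0,\dots,0)$ and $\frac{2}{\sqrt8}(\frac13,-\frac23,\frac13,0,\dots,0)$. 4. Let $S$ be the set of the $s=3$ vertices of any such triangle and let $$V_{22}=\{\pi_V(w): w\in\Lambda_{24},\ \pi_U(w)\in S\}\subset V .$$ The spheres in $V$ of radius $\rho=\frac12\sqrt{\mu-\beta}=\frac12\sqrt{4-\frac13}$ around the points of $V_{22}$ do not overlap, this packing has center density $$\delta=\frac{11^{11}}{2^{23}\,3^{10.5}}=0.3325\ldots,$$ which is larger than the center density $1/\sqrt{12}$ of $\Lambda_{22}$, and each sphere of the packing touches exactly $41472$ others. -/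

import Mathlib

open Filter Topology MeasureTheory
open scoped Pointwise

/-! ### The Golay code and the Leech lattice in MOG coordinates -/

/-- Multiplication by `ω` on the field `𝔽₄ = {0, 1, ω, ω̄ = 1 + ω}`, where `p + q ω` is written
`(p, q)`. -/
def mulOmega (z : ZMod 2 × ZMod 2) : ZMod 2 × ZMod 2 := (z.2, z.1 + z.2)

/-- The hexacode: all words `(a, b, c, φ(1), φ(ω), φ(ω̄))` in `𝔽₄⁶`, where
`φ(x) = a x² + b x + c`. -/
def IsHexacodeword (h : Fin 6 → ZMod 2 × ZMod 2) : Prop :=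
  h 3 = h 0 + h 1 + h 2 ∧
  h 4 = mulOmega (mulOmega (h 0)) + mulOmega (h 1) + h 2 ∧
  h 5 = mulOmega (h 0) + mulOmega (mulOmega (h 1)) + h 2

/-- The entry in column `j` and row `r` of the `4 × 6` MOG array; the 24 coordinates are
numbered column by column. -/
def mog (c : Fin 24 → ZMod 2) (j : Fin 6) (r : Fin 4) : ZMod 2 := c (finProdFinEquiv (j, r))

/-- The score in `𝔽₄` of column `j`, the four rows being labelled `0, 1, ω, ω̄`. -/
def mogScore (c : Fin 24 → ZMod 2) (j : Fin 6) : ZMod 2 × ZMod 2 :=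
  (mog c j 1 + mog c j 3, mog c j 2 + mog c j 3)

/-- The binary Golay code of length 24: the parity of each of the six columns equals the parity of
the top row, and the column scores form a hexacodeword. -/
def golayCode : Submodule (ZMod 2) (Fin 24 → ZMod 2) where
  carrier := {c | (∀ j, ∑ r, mog c j r = ∑ k, mog c k 0) ∧ IsHexacodeword (mogScore c)}
  zero_mem' := by
    simp [mog, mogScore, IsHexacodeword, mulOmega]
  add_mem' := by
    rintro a b ⟨ha, ha3, ha4, ha5⟩ ⟨hb, hb3, hb4, hb5⟩
    have hs : ∀ j, mogScore (a + b) j = mogScore a j + mogScore b j := fun j => by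
      ext <;> simp [mogScore, mog] <;> ring
    have hm : ∀ x y, mulOmega (x + y) = mulOmega x + mulOmega y := fun x y => by
      ext <;> simp [mulOmega] <;> ring
    refine ⟨fun j => ?_, ?_, ?_, ?_⟩
    · simpa [mog, Finset.sum_add_distrib] using congrArg₂ (· + ·) (ha j) (hb j)
    · simp only [hs, ha3, hb3]; abel
    · simp only [hs, hm, ha4, hb4]; abel
    · simp only [hs, hm, ha5, hb5]; abel
  smul_mem' := by
    rintro t c ⟨h, h3, h4, h5⟩
    have hs : ∀ j, mogScore (t • c) j = t • mogScore c j := fun j => by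
      ext <;> simp [mogScore, mog] <;> ring
    have hm : ∀ x, mulOmega (t • x) = t • mulOmega x := fun x => by
      ext <;> simp [mulOmega] <;> ring
    refine ⟨fun j => ?_, ?_, ?_, ?_⟩
    · simpa [mog, Finset.mul_sum] using congrArg (t * ·) (h j)
    · simp only [hs, h3, smul_add]
    · simp only [hs, hm, h4, smul_add]
    · simp only [hs, hm, h5, smul_add]

/-- The Leech lattice `Λ₂₄`: the vectors `(a₁, …, a₂₄) / √8` with integers `aᵢ` such that, for
some integer `m`, all `aᵢ ≡ m (mod 2)`, the `(aᵢ - m) / 2` reduce modulo 2 to a Golay codeword,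
and `∑ aᵢ ≡ 4 m (mod 8)`. -/
noncomputable def leechLattice : Submodule ℤ (EuclideanSpace ℝ (Fin 24)) where
  carrier := {x | ∃ (a b : Fin 24 → ℤ) (m : ℤ), (∀ i, x i = (a i : ℝ) / √8) ∧
    (∀ i, a i = m + 2 * b i) ∧ (fun i => (b i : ZMod 2)) ∈ golayCode ∧
    ∑ i, a i ≡ 4 * m [ZMOD 8]}
  zero_mem' := ⟨0, 0, 0, by simp, by simp, by
    convert golayCode.zero_mem using 1
    ext i; simp, by simp⟩
  add_mem' := by
    rintro x y ⟨a, b, m, hx, ha, hb, hm⟩ ⟨a', b', m', hx', ha', hb', hm'⟩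
    refine ⟨a + a', b + b', m + m', fun i => ?_, fun i => ?_, ?_, ?_⟩
    · simp [hx, hx', add_div]
    · simp only [Pi.add_apply, ha, ha']; ring
    · convert golayCode.add_mem hb hb' using 1
      ext i; simp
    · simpa [Finset.sum_add_distrib, mul_add] using hm.add hm'
  smul_mem' := by
    rintro t x ⟨a, b, m, hx, ha, hb, hm⟩
    refine ⟨fun i => t * a i, fun i => t * b i, t * m, fun i => ?_, fun i => ?_, ?_, ?_⟩
    · simp [hx, mul_div_assoc]
    · simp only [ha]; ring
    · convert golayCode.smul_mem (t : ZMod 2) hb using 1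
      ext i; simp
    · have := hm.mul_left t
      rw [Finset.mul_sum] at this
      rwa [show 4 * (t * m) = t * (4 * m) by ring]

/-! ### The root lattice `A₂` and its dual -/

/-- `A₂ = {x ∈ ℤ³ : x₁ + x₂ + x₃ = 0}`. -/
def rootLatticeA2 : Set (EuclideanSpace ℝ (Fin 3)) :=
  {x | (∀ i, ∃ n : ℤ, x i = n) ∧ ∑ i, x i = 0}

/-- The dual of a lattice, inside the real span of the lattice. -/
def dualLattice {W : Type*} [NormedAddCommGroup W] [InnerProductSpace ℝ W] (L : Set W) : Set W :=
  {y | y ∈ Submodule.span ℝ L ∧ ∀ x ∈ L, ∃ n : ℤ, inner ℝ x y = n}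

/-! ### Lattices and sphere packings -/

section Packings

variable {W : Type*} [NormedAddCommGroup W] [InnerProductSpace ℝ W]

/-- The minimal norm, i.e. squared length, of the nonzero vectors of `L` is `μ`. -/
def HasMinNorm (L : Submodule ℤ W) (μ : ℝ) : Prop :=
  IsLeast {t : ℝ | ∃ x ∈ L, x ≠ 0 ∧ ‖x‖ ^ 2 = t} μ

/-- `L` is an `n`-dimensional lattice of determinant `d`: it has a `ℤ`-basis of `n` vectors that
are linearly independent over `ℝ` and whose Gram matrix has determinant `d`. -/
def IsLatticeOfDet (L : Submodule ℤ W) (n : ℕ) (d : ℝ) : Prop :=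
  ∃ b : Fin n → W, LinearIndependent ℝ b ∧ Submodule.span ℤ (Set.range b) = L ∧
    (Matrix.of fun i j => (inner ℝ (b i) (b j) : ℝ)).det = d

/-- The section of the lattice `L` by the linear subspace `V`. -/
def latticeSection (L : Submodule ℤ W) (V : Submodule ℝ W) : Submodule ℤ W :=
  L ⊓ V.restrictScalars ℤ

/-- The orthogonal projection of the lattice `L` to the linear subspace `V`. -/
noncomputable def latticeProjection (L : Submodule ℤ W) (V : Submodule ℝ W)
    [V.HasOrthogonalProjection] : Submodule ℤ W :=
  L.map (V.starProjection.toLinearMap.restrictScalars ℤ)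

/-- The antipode construction `𝒜(S) = {π_V w : w ∈ L, π_U w ∈ S} ⊆ V`, where `U` is the orthogonal
complement of `V`. -/
noncomputable def antipode (L : Submodule ℤ W) (V : Submodule ℝ W)
    [V.HasOrthogonalProjection] (S : Set W) : Set V :=
  {v | ∃ w ∈ L, Vᗮ.starProjection w ∈ S ∧ V.orthogonalProjectionOnto w = v}

/-- The spheres of radius `ρ` around the points of `P` do not overlap. -/
def IsSpherePacking {X : Type*} [MetricSpace X] (P : Set X) (ρ : ℝ) : Prop :=
  0 < ρ ∧ ∀ p ∈ P, ∀ q ∈ P, p ≠ q → 2 * ρ ≤ dist p q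

/-- The packing by spheres of radius `ρ` around the points of `P` has center density `δ`: the
fraction of space covered by the (solid) spheres, divided by the volume of the unit ball, is `δ`. -/
def HasCenterDensity [FiniteDimensional ℝ W] [MeasurableSpace W] [BorelSpace W]
    (P : Set W) (ρ δ : ℝ) : Prop :=
  Tendsto (fun R : ℝ =>
    volume.real ((⋃ p ∈ P, Metric.closedBall p ρ) ∩ Metric.ball (0 : W) R) /
      volume.real (Metric.ball (0 : W) R) / volume.real (Metric.ball (0 : W) 1)) atTop (𝓝 δ)

/-- The spheres of radius `ρ` around points of `P` that touch the sphere around `p`, given by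
their centers. -/
def touching {X : Type*} [MetricSpace X] (P : Set X) (ρ : ℝ) (p : X) : Set X :=
  {q | q ∈ P ∧ q ≠ p ∧ dist p q = 2 * ρ}

/-- `S` consists of the three vertices of an equilateral triangle in the lattice `M` whose sides
have squared length `β`. -/
def IsEquilateralTriangle (M : Submodule ℤ W) (β : ℝ) (S : Set W) : Prop :=
  S.ncard = 3 ∧ S ⊆ M ∧ ∀ x ∈ S, ∀ y ∈ S, x ≠ y → dist x y ^ 2 = β

end Packings

/-! ### The data of the construction in dimension 22 -/

/-- The subspace `V` of the vectors in `ℝ²⁴` beginning with three equal coordinates. -/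
def threeEqual : Submodule ℝ (EuclideanSpace ℝ (Fin 24)) where
  carrier := {x | x 0 = x 1 ∧ x 1 = x 2}
  zero_mem' := by simp
  add_mem' := by
    rintro x y ⟨h1, h2⟩ ⟨h3, h4⟩
    simp [h1, h2, h3, h4]
  smul_mem' := by
    rintro t x ⟨h1, h2⟩
    simp [h1, h2]

/-- The laminated lattice `Λ₂₂` in its standard coordinates: the vectors of the Leech lattice
beginning with three equal coordinates. -/
noncomputable def laminated22 : Submodule ℤ (EuclideanSpace ℝ (Fin 24)) :=
  latticeSection leechLattice threeEqual

/-- The vector `(2 / √8) (x, y, z, 0, …, 0)` of `ℝ²⁴`. -/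
noncomputable def startVec (x y z : ℝ) : EuclideanSpace ℝ (Fin 24) :=
  (2 / √8) • (EuclideanSpace.single 0 x + EuclideanSpace.single 1 y + EuclideanSpace.single 2 z)

/-- The vertices of an explicit triangle: the projections to `U` of vectors of the Leech lattice
beginning `(a, a, a) / √8`, `(a + 2, a, a) / √8` and `(a, a - 2, a) / √8`. -/
noncomputable def explicitTriangle : Set (EuclideanSpace ℝ (Fin 24)) :=
  {startVec 0 0 0, startVec (2 / 3) (-1 / 3) (-1 / 3), startVec (1 / 3) (-2 / 3) (1 / 3)}

/-! Write `L` for the Leech lattice. The fibre of `L` over a point of `π_U(L)`, projected to `V`, is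
a translate of `Λ₂₂ = L ∩ V`. Hence the construction over a triangle `S` is a union of three cosets
of `Λ₂₂`, and they are distinct: otherwise a difference of two vertices, of norm `1/3`, would lie in
`L`, whose minimal norm is `4`. By Pythagoras, `π_V w` and `π_V w'` are at squared distance `‖w -
w'‖² - ‖π_U (w - w')‖²`, which is at least `4` over one vertex and at least `4 - 1/3` over two
different ones. So the radius shrinks from `1` to `ρ` with `ρ² = 11/12`, while the number of centers
triples. A union of `N` cosets has center density `N ρⁿ / covol` (`hasCenterDensity_of_cosets`), and
`Λ₂₂` has covolume `√12` by an explicit triangular basis (`det_gram_lamBasis`), so the density is `3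
(11/12)¹¹ / √12`.

For the contact number, points over the same vertex are too far apart to touch. The neighbors over
another vertex correspond to the minimal vectors of `L` with a prescribed projection of norm `1/3`
to `U` (`ncard_touching_fiber`). Up to sign and a cyclic shift of the first three coordinates, these
are the minimal vectors beginning `(t + 2, t, t) / √8`. The equality cases of the proof that the
minimal norm is `4` give their shapes: `(3, 1, 1, ±1²¹)`, `512` of them; `(1, -1, -1, …)` with one
`±3` further on, `512 · 21`; `(2, 0, 0, …)` on octads, `120 · 64`; `(0, -2, -2, …)` on octads, `56 ·
32`. The total is `20736` (`ncard_startMinVecs`), and the two other vertices give `2 · 20736 =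
41472`. What is needed of the Golay code (weights, and counts of words with a given pattern at three
positions) is found by enumerating its `4096` words as bit masks. -/

/-! ### Center density of periodic packings -/

section Density

variable {E : Type*} [NormedAddCommGroup E] [InnerProductSpace ℝ E] [FiniteDimensional ℝ E]
  [MeasurableSpace E] [BorelSpace E]

/-- Moving the radius by a constant does not affect the leading term. This absorbs all boundary
effects below: translating a lattice, and balls that cross the boundary of the large ball. -/
theorem tendsto_div_pow_add {f : ℝ → ℝ} {n : ℕ} {l : ℝ} (a : ℝ)
    (h : Tendsto (fun R => f R / R ^ n) atTop (𝓝 l)) :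
    Tendsto (fun R => f (R + a) / R ^ n) atTop (𝓝 l) := by
  have h1 : Tendsto (fun R : ℝ => ((R + a) / R) ^ n) atTop (𝓝 1) := by
    have : Tendsto (fun R : ℝ => 1 + a / R) atTop (𝓝 (1 + 0)) :=
      tendsto_const_nhds.add (tendsto_const_nhds.div_atTop tendsto_id)
    have h2 : Tendsto (fun R : ℝ => (R + a) / R) atTop (𝓝 1) := by
      rw [add_zero] at this
      refine this.congr' ?_
      filter_upwards [eventually_gt_atTop 0] with R hR
      field_simp
    simpa using h2.pow n
  have h3 := (h.comp (tendsto_atTop_add_const_right atTop a tendsto_id)).mul h1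
  rw [mul_one] at h3
  refine h3.congr' ?_
  filter_upwards [eventually_gt_atTop 0, eventually_gt_atTop (-a)] with R hR hRa
  have : R + a ≠ 0 := by linarith
  simp only [Function.comp, id, div_pow]
  field_simp

variable (L : Submodule ℤ E) [DiscreteTopology L]

omit [MeasurableSpace E] [BorelSpace E] in
theorem finite_closedBall_inter_lattice (x : E) (R : ℝ) :
    (Metric.closedBall x R ∩ (L : Set E)).Finite := by
  have : DiscreteTopology L.toAddSubgroup := inferInstanceAs (DiscreteTopology L)
  have hc : IsClosed (L.toAddSubgroup : Set E) := AddSubgroup.isClosed_of_discrete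
  exact Metric.finite_isBounded_inter_isClosed (s := (L : Set E)) ⟨this⟩
    Metric.isBounded_closedBall hc

omit [MeasurableSpace E] [BorelSpace E] in
theorem finite_closedBall_inter_coset (t : E) (R : ℝ) :
    (Metric.closedBall 0 R ∩ {x | x - t ∈ L}).Finite := by
  refine ((finite_closedBall_inter_lattice L (-t) R).image (· + t)).subset ?_
  rintro x ⟨hx, hxt⟩
  exact ⟨x - t, ⟨by simpa [dist_eq_norm] using hx, hxt⟩, by simp⟩

theorem tendsto_ncard_closedBall_inter_lattice [IsZLattice ℝ L] [Nontrivial E] :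
    Tendsto (fun R : ℝ => ((Metric.closedBall 0 R ∩ (L : Set E)).ncard : ℝ) /
      R ^ Module.finrank ℝ E) atTop
      (𝓝 (volume.real (Metric.ball (0 : E) 1) / ZLattice.covolume L)) := by
  set n := Module.finrank ℝ E with hn
  have hn0 : n ≠ 0 := Module.finrank_pos.ne'
  have hball : ∀ R : ℝ, 0 ≤ R →
      {x ∈ (Set.univ : Set E) | ‖x‖ ^ n ≤ R ^ n} = Metric.closedBall 0 R := by
    intro R hR
    ext x
    simp [pow_le_pow_iff_left₀ (norm_nonneg x) hR hn0]
  have h1 := hball 1 zero_le_one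
  rw [one_pow] at h1
  -- The lattice point count is stated for a function homogeneous of degree `n`; with `‖x‖ ^ n` its
  -- sublevel set at `R ^ n` is the ball of radius `R`.
  have key := ZLattice.covolume.tendsto_card_le_div' L (X := Set.univ) (F := fun x => ‖x‖ ^ n)
    (fun _ _ _ _ => trivial)
    (fun x r hr => by rw [norm_smul, Real.norm_of_nonneg hr, mul_pow])
    (by rw [h1]; exact Metric.isBounded_closedBall)
    (by rw [h1]; exact measurableSet_closedBall)
    (by rw [h1, frontier_closedBall _ one_ne_zero]; exact Measure.addHaar_sphere _ _ _)
  rw [h1, Measure.addHaar_real_closedBall_eq_addHaar_real_ball] at key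
  refine (key.comp (tendsto_pow_atTop hn0)).congr' ?_
  filter_upwards [eventually_ge_atTop 0] with R hR
  simp only [Function.comp]
  rw [hball R hR, Set.ncard_def]
  rfl

/-- Translation by `t` moves points by `‖t‖`, so the count is squeezed between the lattice counts
for the radii `R - ‖t‖` and `R + ‖t‖`. -/
theorem tendsto_ncard_closedBall_inter_coset [IsZLattice ℝ L] [Nontrivial E] (t : E) :
    Tendsto (fun R : ℝ => ((Metric.closedBall 0 R ∩ {x | x - t ∈ L}).ncard : ℝ) /
      R ^ Module.finrank ℝ E) atTop
      (𝓝 (volume.real (Metric.ball (0 : E) 1) / ZLattice.covolume L)) := by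
  have h := tendsto_ncard_closedBall_inter_lattice L
  refine tendsto_of_tendsto_of_tendsto_of_le_of_le' (tendsto_div_pow_add (-‖t‖) h)
    (tendsto_div_pow_add ‖t‖ h) ?_ ?_
  · filter_upwards [eventually_gt_atTop 0] with R hR
    refine div_le_div_of_nonneg_right (Nat.cast_le.2 ?_) (by positivity)
    refine Set.ncard_le_ncard_of_injOn (· + t) ?_ (add_left_injective t).injOn
      (ht := finite_closedBall_inter_coset L t R)
    rintro x ⟨hx, hxL⟩
    refine ⟨?_, by simpa using hxL⟩
    rw [mem_closedBall_zero_iff] at hx ⊢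
    linarith [norm_add_le x t]
  · filter_upwards [eventually_gt_atTop 0] with R hR
    refine div_le_div_of_nonneg_right (Nat.cast_le.2 ?_) (by positivity)
    refine Set.ncard_le_ncard_of_injOn (· - t) ?_ (fun _ _ _ _ h => sub_left_injective h)
      (ht := finite_closedBall_inter_lattice L 0 _)
    rintro x ⟨hx, hxL⟩
    refine ⟨?_, hxL⟩
    rw [mem_closedBall_zero_iff] at hx ⊢
    linarith [norm_sub_le x t]

/-- A periodic sphere packing, whose centers form finitely many cosets of a lattice, has center
density `N ρ ^ n / covol`. -/
theorem hasCenterDensity_of_cosets [IsZLattice ℝ L] [Nontrivial E] {P : Set E} {ρ : ℝ}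
    (hpack : IsSpherePacking P ρ) (T : Finset E) (hP : ∀ x, x ∈ P ↔ ∃ t ∈ T, x - t ∈ L)
    (hT : ∀ s ∈ T, ∀ t ∈ T, s - t ∈ L → s = t) :
    HasCenterDensity P ρ (T.card * ρ ^ Module.finrank ℝ E / ZLattice.covolume L) := by
  obtain ⟨hρ, hdist⟩ := hpack
  set n := Module.finrank ℝ E
  set c := volume.real (Metric.ball (0 : E) 1) with hc
  have hc0 : 0 < c := 
    ENNReal.toReal_pos (Metric.measure_ball_pos _ _ zero_lt_one).ne' measure_ball_lt_top.ne
  have hdecomp : ∀ R : ℝ, Metric.closedBall 0 R ∩ P =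
      ⋃ t ∈ T, (Metric.closedBall 0 R ∩ {x | x - t ∈ L}) := by
    intro R
    ext x
    simp only [Set.mem_inter_iff, Set.mem_iUnion, Set.mem_ofPred_eq, hP]
    tauto
  have hfin : ∀ R : ℝ, (Metric.closedBall 0 R ∩ P).Finite := fun R => by
    rw [hdecomp]
    exact T.finite_toSet.biUnion fun t _ => finite_closedBall_inter_coset L t R
  have hcount : Tendsto (fun R : ℝ => ((Metric.closedBall 0 R ∩ P).ncard : ℝ) / R ^ n) atTop
      (𝓝 (T.card * (c / ZLattice.covolume L))) := by
    have := tendsto_finsetSum T fun t _ => tendsto_ncard_closedBall_inter_coset L t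
    rw [Finset.sum_const, nsmul_eq_mul] at this
    refine this.congr fun R => ?_
    rw [← Finset.sum_div, ← Nat.cast_sum, hdecomp]
    congr 2
    classical
    have e : (⋃ t ∈ T, (Metric.closedBall 0 R ∩ {x | x - t ∈ L})) =
        (T.biUnion fun t => (finite_closedBall_inter_coset L t R).toFinset : Finset E) := by
      ext; simp
    rw [e, Set.ncard_coe_finset, Finset.card_biUnion]
    · exact Finset.sum_congr rfl fun t _ => by
        rw [← Set.ncard_coe_finset, Set.Finite.coe_toFinset]
    · intro s hs t ht hst
      refine Finset.disjoint_left.2 fun x hx hx' => hst (hT s hs t ht ?_)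
      simp only [Set.Finite.mem_toFinset, Set.mem_inter_iff, Set.mem_ofPred_eq] at hx hx'
      simpa using L.sub_mem hx'.2 hx.2
  have hvol : ∀ (x : E) (r : ℝ), 0 ≤ r → volume.real (Metric.closedBall x r) = r ^ n * c :=
    fun x r hr => Measure.addHaar_real_closedBall _ _ hr
  -- A sphere that meets the ball of radius `R` has its center within `R + ρ`.
  have hup : ∀ R : ℝ, volume.real ((⋃ p ∈ P, Metric.closedBall p ρ) ∩ Metric.ball (0 : E) R) ≤
      (Metric.closedBall 0 (R + ρ) ∩ P).ncard * (ρ ^ n * c) := by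
    intro R
    have hs : (⋃ p ∈ P, Metric.closedBall p ρ) ∩ Metric.ball (0 : E) R ⊆
        ⋃ p ∈ (hfin (R + ρ)).toFinset, Metric.closedBall p ρ := by
      rintro x ⟨hx, hxR⟩
      simp only [Set.mem_iUnion] at hx ⊢
      obtain ⟨p, hp, hxp⟩ := hx
      refine ⟨p, ?_, hxp⟩
      simp only [Set.Finite.mem_toFinset]
      refine ⟨?_, hp⟩
      rw [Metric.mem_closedBall] at hxp ⊢
      rw [Metric.mem_ball] at hxR
      linarith [dist_triangle_left p 0 x]
    refine (measureReal_mono hs ?_).trans ((measureReal_biUnion_finset_le _ _).trans ?_)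
    · exact ((measure_biUnion_lt_top (Finset.finite_toSet _)
        fun p _ => measure_closedBall_lt_top)).ne
    · rw [Finset.sum_congr rfl fun p _ => hvol p ρ hρ.le, Finset.sum_const, nsmul_eq_mul,
        ← Set.ncard_eq_toFinset_card _ (hfin _)]
  -- Spheres with center within `R - ρ` lie in the large ball. Their open interiors are disjoint, so
  -- the volumes add up.
  have hlow : ∀ R : ℝ, (Metric.closedBall 0 (R + -ρ) ∩ P).ncard * (ρ ^ n * c) ≤
      volume.real ((⋃ p ∈ P, Metric.closedBall p ρ) ∩ Metric.ball (0 : E) R) := by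
    intro R
    have hs : ⋃ p ∈ (hfin (R + -ρ)).toFinset, Metric.ball p ρ ⊆
        (⋃ p ∈ P, Metric.closedBall p ρ) ∩ Metric.ball (0 : E) R := by
      intro x hx
      simp only [Set.mem_iUnion, Set.Finite.mem_toFinset] at hx
      obtain ⟨p, ⟨hpR, hp⟩, hxp⟩ := hx
      refine ⟨Set.mem_biUnion hp (Metric.ball_subset_closedBall hxp), ?_⟩
      rw [Metric.mem_closedBall] at hpR
      rw [Metric.mem_ball] at hxp ⊢
      linarith [dist_triangle x p 0]
    have hb : volume.real (⋃ p ∈ (hfin (R + -ρ)).toFinset, Metric.ball p ρ) =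
        (Metric.closedBall 0 (R + -ρ) ∩ P).ncard * (ρ ^ n * c) := by
      rw [measureReal_biUnion_finset]
      · rw [Finset.sum_congr rfl fun p _ =>
          (Measure.addHaar_real_closedBall_eq_addHaar_real_ball volume p ρ).symm.trans
            (hvol p ρ hρ.le), Finset.sum_const, nsmul_eq_mul, ← Set.ncard_eq_toFinset_card _ (hfin _)]
      · intro p hp q hq hpq
        simp only [Set.Finite.coe_toFinset] at hp hq
        refine Metric.ball_disjoint_ball ?_
        linarith [hdist p hp.2 q hq.2 hpq]
      · exact fun p _ => measurableSet_ball
    rw [← hb]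
    exact measureReal_mono hs
      ((measure_mono Set.inter_subset_right).trans_lt measure_ball_lt_top).ne
  have hlim : ∀ a : ℝ, Tendsto (fun R : ℝ => (Metric.closedBall 0 (R + a) ∩ P).ncard * (ρ ^ n * c) /
      volume.real (Metric.ball (0 : E) R) / c) atTop
      (𝓝 (T.card * ρ ^ n / ZLattice.covolume L)) := by
    intro a
    have := (tendsto_div_pow_add a hcount).mul_const (ρ ^ n / c)
    have e : T.card * (c / ZLattice.covolume L) * (ρ ^ n / c) =
        T.card * ρ ^ n / ZLattice.covolume L := by field_simp
    rw [e] at this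
    refine this.congr' ?_
    filter_upwards [eventually_gt_atTop 0] with R hR
    rw [← Measure.addHaar_real_closedBall_eq_addHaar_real_ball, hvol 0 R hR.le]
    field_simp
  refine tendsto_of_tendsto_of_tendsto_of_le_of_le (hlim (-ρ)) (hlim ρ) ?_ ?_
  · intro R
    simp only
    gcongr
    exact hlow R
  · intro R
    simp only
    gcongr
    exact hup R

/-- The covolume of a lattice is the square root of the Gram determinant of a basis. -/
theorem covolume_span_eq_sqrt_det_gram {ι : Type*} [Fintype ι] [DecidableEq ι]
    (b : Module.Basis ι ℝ E) :
    ZLattice.covolume (Submodule.span ℤ (Set.range b)) = √(Matrix.gram ℝ b).det := by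
  let e : Fin (Module.finrank ℝ E) ≃ ι :=
    Fintype.equivOfCardEq (by rw [Fintype.card_fin, Module.finrank_eq_card_basis b])
  let o := (stdOrthonormalBasis ℝ E).reindex e
  -- If `B` is the matrix of the basis in orthonormal coordinates, the fundamental domain has volume
  -- `|det B|` and the Gram matrix is `Bᵀ B`.
  rw [ZLattice.covolume_eq_measure_fundamentalDomain _ _ (ZSpan.isAddFundamentalDomain b volume),
    ZSpan.measureReal_fundamentalDomain b volume o.toBasis,
    measureReal_congr (ZSpan.fundamentalDomain_ae_parallelepiped _ _), OrthonormalBasis.coe_toBasis,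
    measureReal_def, o.volume_parallelepiped, Matrix.gram_eq_conjTranspose_mul o, Matrix.det_mul,
    Matrix.conjTranspose_eq_transpose_of_trivial, Matrix.det_transpose, Real.sqrt_mul_self_eq_abs]
  simp only [ENNReal.toReal_one, mul_one, Module.Basis.det_apply]
  rfl

end Density

/-! ### The Golay code as a list of bit masks -/

section Golay

/-- The words generated by a list of bit masks, as bit masks. -/
def maskSpan : List ℕ → List ℕ
  | [] => [0]
  | g :: gs => maskSpan gs ++ (maskSpan gs).map (g ^^^ ·)

/-- The word of length 24 with the given bit mask. -/
def maskWord (w : ℕ) (i : Fin 24) : ZMod 2 := if w.testBit i then 1 else 0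

/-- The number of ones among the last `n` binary digits. -/
def popCount : ℕ → ℕ → ℕ
  | 0, _ => 0
  | n + 1, w => w % 2 + popCount n (w / 2)

/-- The Hamming weight. -/
def wordWeight (c : Fin 24 → ZMod 2) : ℕ := (Finset.univ.filter fun i => c i ≠ 0).card

/-- The information positions of `golayMasks`. -/
def golayPivots : List (Fin 24) := [0, 1, 2, 3, 4, 5, 6, 8, 9, 10, 12, 16]

/-- A systematic generator matrix of the Golay code. -/
def golayMasks : List ℕ :=
  [2418817, 7481474, 12077188, 2001032, 6054032, 13017248, 6996160, 9857280, 11184640, 13421568,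
    15790080, 16711680]

theorem maskWord_xor (v w : ℕ) : maskWord (v ^^^ w) = maskWord v + maskWord w := by
  ext i
  simp only [maskWord, Nat.testBit_xor, Pi.add_apply]
  cases v.testBit i <;> cases w.testBit i <;> decide

theorem maskWord_zero : maskWord 0 = 0 := by
  ext i
  simp [maskWord]

theorem popCount_eq_sum (n w : ℕ) :
    popCount n w = ∑ i : Fin n, if w.testBit i then 1 else 0 := by
  induction n generalizing w with
  | zero => rfl
  | succ n ih =>
    rw [popCount, ih, Fin.sum_univ_succ]
    congr 1
    · simp only [Fin.val_zero, Nat.testBit_zero]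
      rcases Nat.mod_two_eq_zero_or_one w with h | h <;> simp [h]
    · simp [Nat.testBit_succ]

theorem wordWeight_maskWord (w : ℕ) : wordWeight (maskWord w) = popCount 24 w := by
  rw [popCount_eq_sum, wordWeight, Finset.card_filter]
  refine Finset.sum_congr rfl fun i _ => ?_
  unfold maskWord
  cases w.testBit i <;> simp

theorem mem_golayCode_iff {c : Fin 24 → ZMod 2} :
    c ∈ golayCode ↔ (∀ j, ∑ r, mog c j r = ∑ k, mog c k 0) ∧ IsHexacodeword (mogScore c) :=
  Iff.rfl

instance : DecidablePred (· ∈ golayCode) := fun c =>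
  inferInstanceAs (Decidable ((∀ j, ∑ r, mog c j r = ∑ k, mog c k 0) ∧
    (mogScore c 3 = _ ∧ mogScore c 4 = _ ∧ mogScore c 5 = _)))

theorem maskWord_mem_golayCode : ∀ g ∈ golayMasks, maskWord g ∈ golayCode := by
  decide +kernel

/-- The positions `golayPivots` fill the first column and, up to its last entry, the next two, and
contain the top entries of columns 3 and 4. The parity rule then kills the remaining entries of the
top row and of columns 1 and 2. The scores of columns 0 to 2 vanish, hence by the hexacode so do the
others; zero score, even parity and zero top entry force a column to vanish. -/
theorem golay_ext {c : Fin 24 → ZMod 2} (hc : c ∈ golayCode) (h : ∀ p ∈ golayPivots, c p = 0) :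
    c = 0 := by
  obtain ⟨h1, h2, h3, h4⟩ := mem_golayCode_iff.1 hc
  have e : ∀ j r, mog c j r = c (finProdFinEquiv (j, r)) := fun _ _ => rfl
  simp only [golayPivots, List.mem_cons, List.not_mem_nil, or_false, forall_eq_or_imp,
    forall_eq] at h
  obtain ⟨p0, p1, p2, p3, p4, p5, p6, p8, p9, p10, p12, p16⟩ := h
  simp only [mogScore, mulOmega, Prod.ext_iff, Prod.fst_add, Prod.snd_add, Fin.sum_univ_six,
    Fin.sum_univ_four, Fin.forall_fin_succ, e] at h1 h2 h3 h4
  simp [finProdFinEquiv, p0, p1, p2, p3, p4, p5, p6, p8, p9, p10, p12, p16] at h1 h2 h3 h4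
  obtain ⟨c20, c7, c11, q3, q4, q5⟩ := h1
  rw [← c20] at c7 c11 q3 q4 q5
  simp only [c7, c11, add_zero] at h2 h3 h4
  have key : ∀ x y z : ZMod 2, x + y + z = 0 → x + z = 0 ∧ y + z = 0 → x = 0 ∧ y = 0 ∧ z = 0 := by
    decide
  obtain ⟨c13, c14, c15⟩ := key _ _ _ q3 h2
  obtain ⟨c17, c18, c19⟩ := key _ _ _ q4 h3
  rw [zero_add] at q5
  obtain ⟨c21, c22, c23⟩ := key _ _ _ q5 h4
  ext i
  fin_cases i <;> first | assumption | exact c20.symm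

/-- The encoder: the generators are combined with the entries of `c` at the positions `ps` as
coefficients. -/
theorem exists_mem_maskSpan (c : Fin 24 → ZMod 2) (ps : List (Fin 24)) (gs : List ℕ) :
    ∃ w ∈ maskSpan gs, maskWord w = (List.zipWith (fun p g => c p • maskWord g) ps gs).sum := by
  induction gs generalizing ps with
  | nil => exact ⟨0, by simp [maskSpan], by simp [maskWord_zero]⟩
  | cons g gs ih =>
    have h2 : ∀ z : ZMod 2, z = 0 ∨ z = 1 := by decide
    cases ps with
    | nil =>
      obtain ⟨w, hw, h⟩ := ih []
      exact ⟨w, List.mem_append_left _ hw, by simpa using h⟩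
    | cons p ps =>
      obtain ⟨w, hw, h⟩ := ih ps
      rcases h2 (c p) with hp | hp
      · exact ⟨w, List.mem_append_left _ hw, by simp [h, hp]⟩
      · exact ⟨g ^^^ w, List.mem_append_right _ (List.mem_map_of_mem hw),
          by simp [h, hp, maskWord_xor]⟩

theorem maskWord_mem_of_mem_maskSpan {gs : List ℕ} (hgs : ∀ g ∈ gs, maskWord g ∈ golayCode)
    {w : ℕ} (hw : w ∈ maskSpan gs) : maskWord w ∈ golayCode := by
  induction gs generalizing w with
  | nil =>
    simp only [maskSpan, List.mem_singleton] at hw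
    simp [hw, maskWord_zero]
  | cons g gs ih =>
    simp only [List.mem_cons, forall_eq_or_imp] at hgs
    simp only [maskSpan, List.mem_append, List.mem_map] at hw
    rcases hw with hw | ⟨v, hv, rfl⟩
    · exact ih hgs.2 hw
    · rw [maskWord_xor]
      exact add_mem hgs.1 (ih hgs.2 hv)

theorem mem_golayCode_iff_exists_mask {c : Fin 24 → ZMod 2} :
    c ∈ golayCode ↔ ∃ w ∈ maskSpan golayMasks, maskWord w = c := by
  constructor
  · intro hc
    obtain ⟨w, hw, h⟩ := exists_mem_maskSpan c golayPivots golayMasks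
    refine ⟨w, hw, ?_⟩
    have hwG := maskWord_mem_of_mem_maskSpan maskWord_mem_golayCode hw
    -- The generator matrix is the identity at the pivots, so the encoded word agrees with `c`
    -- there.
    refine sub_eq_zero.1 (golay_ext (sub_mem hwG hc) ?_)
    rw [h]
    simp [golayPivots, golayMasks, maskWord, Nat.testBit, Nat.shiftRight_eq_div_pow]
  · rintro ⟨w, hw, rfl⟩
    exact maskWord_mem_of_mem_maskSpan maskWord_mem_golayCode hw

/-- The number of words `w` of the span with `Q (a ^^^ w)`, by recursion along a binary tree. -/
def maskCount (Q : ℕ → Bool) : List ℕ → ℕ → ℕ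
  | [], a => (Q a).toNat
  | g :: gs, a => maskCount Q gs a + maskCount Q gs (a ^^^ g)

theorem maskCount_eq_countP (Q : ℕ → Bool) (gs : List ℕ) (a : ℕ) :
    maskCount Q gs a = (maskSpan gs).countP fun w => Q (a ^^^ w) := by
  induction gs generalizing a with
  | nil => cases h : Q a <;> simp [maskCount, maskSpan, h]
  | cons g gs ih => simp [maskCount, maskSpan, ih, List.countP_map, Function.comp_def, Nat.xor_assoc]

theorem maskCount_zero (Q : ℕ → Bool) (gs : List ℕ) :
    maskCount Q gs 0 = (maskSpan gs).countP Q := by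
  simp [maskCount_eq_countP]

/-- An exhaustive kernel computation over all `4096` words; `maskCount` avoids building the list. -/
theorem maskSpan_weights : maskCount (fun w =>
    not ([0, 8, 12, 16, 24].contains (popCount 24 w))) golayMasks 0 = 0 := by
  decide +kernel

theorem golay_weight {c : Fin 24 → ZMod 2} (hc : c ∈ golayCode) :
    wordWeight c ∈ [0, 8, 12, 16, 24] := by
  obtain ⟨w, hw, rfl⟩ := mem_golayCode_iff_exists_mask.1 hc
  rw [wordWeight_maskWord]
  have := maskSpan_weights
  rw [maskCount_zero, List.countP_eq_zero] at this
  simpa [Decidable.imp_iff_not_or] using this w hw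

theorem wordWeight_eq_zero {c : Fin 24 → ZMod 2} : wordWeight c = 0 ↔ c = 0 := by
  simp [wordWeight, Finset.filter_eq_empty_iff, funext_iff]

theorem four_dvd_golay_weight {c : Fin 24 → ZMod 2} (hc : c ∈ golayCode) : 4 ∣ wordWeight c := by
  have := golay_weight hc
  simp only [List.mem_cons, List.not_mem_nil, or_false] at this
  omega

theorem eight_le_golay_weight {c : Fin 24 → ZMod 2} (hc : c ∈ golayCode) (h0 : c ≠ 0) :
    8 ≤ wordWeight c := by
  have := golay_weight hc
  have h := mt wordWeight_eq_zero.1 h0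
  simp only [List.mem_cons, List.not_mem_nil, or_false] at this
  omega

theorem one_mem_golayCode : (1 : Fin 24 → ZMod 2) ∈ golayCode := by
  decide +kernel

theorem lt_of_mem_maskSpan {gs : List ℕ} {n : ℕ} (hgs : ∀ g ∈ gs, g < 2 ^ n) {w : ℕ}
    (hw : w ∈ maskSpan gs) : w < 2 ^ n := by
  induction gs generalizing w with
  | nil =>
    simp only [maskSpan, List.mem_singleton] at hw
    simp [hw]
  | cons g gs ih =>
    simp only [List.mem_cons, forall_eq_or_imp] at hgs
    simp only [maskSpan, List.mem_append, List.mem_map] at hw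
    rcases hw with hw | ⟨v, hv, rfl⟩
    · exact ih hgs.2 hw
    · exact Nat.xor_lt_two_pow hgs.1 (ih hgs.2 hv)

theorem maskWord_injOn : Set.InjOn maskWord {w | w < 2 ^ 24} := by
  intro v hv w hw h
  refine Nat.eq_of_testBit_eq fun i => ?_
  rcases lt_or_ge i 24 with hi | hi
  · have := congrFun h ⟨i, hi⟩
    simp only [maskWord] at this
    cases h1 : v.testBit i <;> cases h2 : w.testBit i <;> simp_all
  · have hp : 2 ^ 24 ≤ 2 ^ i := Nat.pow_le_pow_right two_pos hi
    rw [Nat.testBit_lt_two_pow (lt_of_lt_of_le hv hp), Nat.testBit_lt_two_pow (lt_of_lt_of_le hw hp)]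

theorem testBit_eq_false_of_mem_maskSpan {gs : List ℕ} {k : ℕ}
    (hk : ∀ g ∈ gs, g.testBit k = false) {w : ℕ} (hw : w ∈ maskSpan gs) : w.testBit k = false := by
  induction gs generalizing w with
  | nil =>
    simp only [maskSpan, List.mem_singleton] at hw
    simp [hw]
  | cons g gs ih =>
    simp only [List.mem_cons, forall_eq_or_imp] at hk
    simp only [maskSpan, List.mem_append, List.mem_map] at hw
    rcases hw with hw | ⟨v, hv, rfl⟩
    · exact ih hk.2 hw
    · rw [Nat.testBit_xor, hk.1, ih hk.2 hv]
      rfl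

/-- The bit `k` tells the two halves of the span apart: it is set exactly in the words that use `g`.
-/
theorem nodup_maskSpan_cons {g : ℕ} {gs : List ℕ} (k : ℕ)
    (hg : g.testBit k = true ∧ ∀ g' ∈ gs, g'.testBit k = false) (h : (maskSpan gs).Nodup) :
    (maskSpan (g :: gs)).Nodup := by
  refine h.append (h.map (Nat.xor_right_injective)) fun w hw hw' => ?_
  obtain ⟨v, hv, rfl⟩ := List.mem_map.1 hw'
  have h1 := testBit_eq_false_of_mem_maskSpan hg.2 hw
  rw [Nat.testBit_xor, hg.1, testBit_eq_false_of_mem_maskSpan hg.2 hv] at h1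
  simp at h1

theorem nodup_maskSpan : (maskSpan golayMasks).Nodup := by
  refine nodup_maskSpan_cons 0 (by decide) <| nodup_maskSpan_cons 1 (by decide) <|
    nodup_maskSpan_cons 2 (by decide) <| nodup_maskSpan_cons 3 (by decide) <|
    nodup_maskSpan_cons 4 (by decide) <| nodup_maskSpan_cons 5 (by decide) <|
    nodup_maskSpan_cons 6 (by decide) <| nodup_maskSpan_cons 8 (by decide) <|
    nodup_maskSpan_cons 9 (by decide) <| nodup_maskSpan_cons 10 (by decide) <|
    nodup_maskSpan_cons 12 (by decide) <| nodup_maskSpan_cons 16 (by decide) ?_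
  simp [maskSpan]

/-- Masks in the span are distinct and below `2 ^ 24`, so they correspond bijectively to codewords
and counting can be done on the list. -/
theorem card_golay_filter (P : (Fin 24 → ZMod 2) → Prop) [DecidablePred P] (Q : ℕ → Bool)
    (h : ∀ w, P (maskWord w) ↔ Q w = true) :
    (Finset.univ.filter fun c => c ∈ golayCode ∧ P c).card = (maskSpan golayMasks).countP Q := by
  have e : (Finset.univ.filter fun c => c ∈ golayCode ∧ P c) =
      ((maskSpan golayMasks).filter Q).toFinset.image maskWord := by
    ext c
    simp only [Finset.mem_filter, Finset.mem_univ, true_and, Finset.mem_image, List.mem_toFinset,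
      List.mem_filter, mem_golayCode_iff_exists_mask]
    constructor
    · rintro ⟨⟨w, hw, rfl⟩, hP⟩
      exact ⟨w, ⟨hw, (h w).1 hP⟩, rfl⟩
    · rintro ⟨w, ⟨hw, hQ⟩, rfl⟩
      exact ⟨⟨w, hw, rfl⟩, (h w).2 hQ⟩
  rw [e, Finset.card_image_of_injOn, List.toFinset_card_of_nodup (nodup_maskSpan.filter _),
    List.countP_eq_length_filter]
  refine maskWord_injOn.mono fun w hw => ?_
  simp only [List.coe_toFinset, List.mem_filter, Set.mem_ofPred_eq] at hw
  exact lt_of_mem_maskSpan (by decide) hw.1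

/-- The numbers of Golay codewords, and of octads, with the patterns `100` and `011` at three
positions. -/
def StartCounts (i j k : ℕ) : Prop :=
  maskCount (fun w => w.testBit i && (!w.testBit j && !w.testBit k)) golayMasks 0 = 512 ∧
  maskCount (fun w => !w.testBit i && (w.testBit j && w.testBit k)) golayMasks 0 = 512 ∧
  maskCount (fun w => (w.testBit i && (!w.testBit j && !w.testBit k)) && popCount 24 w == 8)
    golayMasks 0 = 120 ∧
  maskCount (fun w => (!w.testBit i && (w.testBit j && w.testBit k)) && popCount 24 w == 8)
    golayMasks 0 = 56

theorem startCounts_zero : StartCounts 0 1 2 := by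
  refine ⟨?_, ?_, ?_, ?_⟩ <;> decide +kernel

theorem startCounts_one : StartCounts 1 2 0 := by
  refine ⟨?_, ?_, ?_, ?_⟩ <;> decide +kernel

theorem startCounts_two : StartCounts 2 0 1 := by
  refine ⟨?_, ?_, ?_, ?_⟩ <;> decide +kernel

theorem StartCounts.card_golay {i j k : Fin 24} (h : StartCounts i j k) :
    (Finset.univ.filter fun c => c ∈ golayCode ∧ (c i = 1 ∧ c j = 0 ∧ c k = 0)).card = 512 ∧
    (Finset.univ.filter fun c => c ∈ golayCode ∧ (c i = 0 ∧ c j = 1 ∧ c k = 1)).card = 512 ∧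
    (Finset.univ.filter fun c => c ∈ golayCode ∧
      ((c i = 1 ∧ c j = 0 ∧ c k = 0) ∧ wordWeight c = 8)).card = 120 ∧
    (Finset.univ.filter fun c => c ∈ golayCode ∧
      ((c i = 0 ∧ c j = 1 ∧ c k = 1) ∧ wordWeight c = 8)).card = 56 := by
  obtain ⟨h1, h2, h3, h4⟩ := h
  rw [maskCount_zero] at h1 h2 h3 h4
  refine ⟨(card_golay_filter _ _ ?_).trans h1, (card_golay_filter _ _ ?_).trans h2,
    (card_golay_filter _ _ ?_).trans h3, (card_golay_filter _ _ ?_).trans h4⟩ <;> intro w <;>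
    simp [maskWord, wordWeight_maskWord]

end Golay

/-! ### Minimal norm and minimal vectors of the Leech lattice -/

section Leech

/-- The integer vectors `a` with `a / √8` in the Leech lattice. -/
def IsLeechVec (a : Fin 24 → ℤ) : Prop :=
  ∃ (b : Fin 24 → ℤ) (m : ℤ), (∀ i, a i = m + 2 * b i) ∧
    (fun i => (b i : ZMod 2)) ∈ golayCode ∧ ∑ i, a i ≡ 4 * m [ZMOD 8]

/-- The real vector `a / √8`. -/
noncomputable def scaledVec : (Fin 24 → ℤ) →+ EuclideanSpace ℝ (Fin 24) where
  toFun a := WithLp.toLp 2 fun i => (a i : ℝ) / √8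
  map_zero' := by ext; simp
  map_add' a b := by ext; simp [add_div]

@[simp]
theorem scaledVec_apply (a : Fin 24 → ℤ) (i : Fin 24) : scaledVec a i = (a i : ℝ) / √8 := rfl

theorem mem_leechLattice_iff {x : EuclideanSpace ℝ (Fin 24)} :
    x ∈ leechLattice ↔ ∃ a, IsLeechVec a ∧ scaledVec a = x := by
  constructor
  · rintro ⟨a, b, m, hx, h⟩
    exact ⟨a, ⟨b, m, h⟩, by ext i; simp [hx]⟩
  · rintro ⟨a, ⟨b, m, h⟩, rfl⟩
    exact ⟨a, b, m, fun i => rfl, h⟩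

theorem scaledVec_injective : Function.Injective scaledVec := by
  intro a b h
  ext i
  have := congrArg (fun x : EuclideanSpace ℝ (Fin 24) => x i) h
  simpa [div_left_inj'] using this

theorem scaledVec_mem_leechLattice {a : Fin 24 → ℤ} : scaledVec a ∈ leechLattice ↔ IsLeechVec a := by
  rw [mem_leechLattice_iff]
  constructor
  · rintro ⟨b, hb, h⟩
    rwa [← scaledVec_injective h]
  · exact fun h => ⟨a, h, rfl⟩

theorem norm_sq_scaledVec (a : Fin 24 → ℤ) : ‖scaledVec a‖ ^ 2 = ((∑ i, a i ^ 2 : ℤ) : ℝ) / 8 := by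
  rw [EuclideanSpace.norm_sq_eq]
  simp [div_pow, Finset.sum_div]

theorem intCast_zmod_two_eq_zero {n : ℤ} : (n : ZMod 2) = 0 ↔ 2 ∣ n :=
  ZMod.intCast_zmod_eq_zero_iff_dvd n 2

/-- Since the all-ones word is in the code, `m` can be changed by any even number, so `m = 0` and `m
= 1` suffice. -/
theorem isLeechVec_iff {a : Fin 24 → ℤ} : IsLeechVec a ↔
    (∃ b : Fin 24 → ℤ, (∀ i, a i = 2 * b i) ∧ (fun i => (b i : ZMod 2)) ∈ golayCode ∧
      4 ∣ ∑ i, b i) ∨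
    (∃ b : Fin 24 → ℤ, (∀ i, a i = 1 + 2 * b i) ∧ (fun i => (b i : ZMod 2)) ∈ golayCode ∧
      ∑ i, a i ≡ 4 [ZMOD 8]) := by
  constructor
  · rintro ⟨b, m, ha, hb, hs⟩
    have hk : ∀ k : ℤ, (fun i => ((k + b i : ℤ) : ZMod 2)) ∈ golayCode := fun k => by
      convert golayCode.add_mem (golayCode.smul_mem (k : ZMod 2) one_mem_golayCode) hb using 1
      ext i
      simp
    rcases Int.even_or_odd' m with ⟨k, rfl | rfl⟩
    · refine Or.inl ⟨fun i => k + b i, fun i => by rw [ha]; ring, hk k, ?_⟩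
      have : ∑ i, a i = 2 * ∑ i, (k + b i) := by
        rw [Finset.mul_sum]
        exact Finset.sum_congr rfl fun i _ => by rw [ha]; ring
      rw [this] at hs
      have := hs.dvd
      change 4 ∣ ∑ i, (k + b i)
      omega
    · refine Or.inr ⟨fun i => k + b i, fun i => by rw [ha]; ring, hk k, ?_⟩
      refine hs.trans ?_
      rw [Int.modEq_iff_dvd]
      exact ⟨-k, by ring⟩
  · rintro (⟨b, ha, hb, hs⟩ | ⟨b, ha, hb, hs⟩)
    · refine ⟨b, 0, by simpa using ha, hb, ?_⟩
      rw [Finset.sum_congr rfl fun i _ => ha i, ← Finset.mul_sum, Int.modEq_iff_dvd]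
      omega
    · exact ⟨b, 1, ha, hb, by simpa using hs⟩

theorem wordWeight_eq_sum (c : Fin 24 → ZMod 2) :
    (wordWeight c : ℤ) = ∑ i, if c i = 0 then 0 else 1 := by
  rw [wordWeight, Finset.card_filter]
  push_cast
  refine Finset.sum_congr rfl fun i _ => ?_
  by_cases h : c i = 0 <;> simp [h]

/-- The sign `(-1) ^ z`. -/
def bitSign (z : ZMod 2) : ℤ := if z = 0 then 1 else -1

theorem sum_bitSign (c : Fin 24 → ZMod 2) : ∑ i, bitSign (c i) = 24 - 2 * wordWeight c := by
  rw [wordWeight_eq_sum, Finset.mul_sum, eq_sub_iff_add_eq, ← Finset.sum_add_distrib]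
  rw [Finset.sum_congr rfl (g := fun _ => (1 : ℤ))]
  · simp
  · intro i _
    unfold bitSign
    split_ifs <;> norm_num

theorem bitSign_cast_eq {b : ℤ} (h : (1 + 2 * b) ^ 2 = 1) : 1 + 2 * b = bitSign (b : ZMod 2) := by
  unfold bitSign
  rcases sq_eq_one_iff.1 h with h | h
  all_goals simp only [intCast_zmod_two_eq_zero]; split_ifs <;> omega

theorem neg_three_bitSign_cast_eq {b : ℤ} (h : (1 + 2 * b) ^ 2 = 9) :
    1 + 2 * b = -3 * bitSign (b : ZMod 2) := by
  unfold bitSign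
  rcases sq_eq_sq_iff_eq_or_eq_neg.1 (h.trans (by norm_num : (9 : ℤ) = 3 ^ 2)) with h | h
  all_goals simp only [intCast_zmod_two_eq_zero]; split_ifs <;> omega

theorem odd_sq_cases (b : ℤ) : (1 + 2 * b) ^ 2 = 1 ∨ 9 ≤ (1 + 2 * b) ^ 2 := by
  rcases eq_or_ne b 0 with rfl | h0
  · simp
  rcases eq_or_ne b (-1) with rfl | h1
  · simp
  right
  rcases lt_or_gt_of_ne h0 with h | h
  · have : b ≤ -2 := by omega
    nlinarith
  · nlinarith

theorem card_erase_univ (p : Fin 24) : (Finset.univ.erase p).card = 23 := by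
  simp

/-- There are three cases. An even vector with zero codeword is `4 d` with `∑ d` even, so `∑ d²` is
even and positive. With a nonzero codeword, at least eight entries have square at least `4`. An odd
vector has an entry of absolute value at least `3`, giving `9 + 23`. -/
theorem IsLeechVec.le_sum_sq {a : Fin 24 → ℤ} (h : IsLeechVec a) (h0 : a ≠ 0) :
    32 ≤ ∑ i, a i ^ 2 := by
  rcases isLeechVec_iff.1 h with ⟨b, ha, hb, hs⟩ | ⟨b, ha, hb, hs⟩
  · have e : ∑ i, a i ^ 2 = 4 * ∑ i, b i ^ 2 := by
      rw [Finset.mul_sum]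
      exact Finset.sum_congr rfl fun i _ => by rw [ha]; ring
    rw [e]
    by_cases hc : (fun i => (b i : ZMod 2)) = 0
    · have hd : ∀ i, ∃ d, b i = 2 * d := fun i => intCast_zmod_two_eq_zero.1 (congrFun hc i)
      choose d hd using hd
      have e2 : ∑ i, b i ^ 2 = 4 * ∑ i, d i ^ 2 := by
        rw [Finset.mul_sum]
        exact Finset.sum_congr rfl fun i _ => by rw [hd]; ring
      have e3 : ∑ i, b i = 2 * ∑ i, d i := by
        rw [Finset.mul_sum]
        exact Finset.sum_congr rfl fun i _ => hd i
      have hpar : 2 ∣ ∑ i, d i ^ 2 - ∑ i, d i := by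
        rw [← Finset.sum_sub_distrib]
        refine Finset.dvd_sum fun i _ => ?_
        have := (Int.even_mul_pred_self (d i)).two_dvd
        convert this using 1
        ring
      have hpos : 0 < ∑ i, d i ^ 2 := by
        obtain ⟨i, hi⟩ := Function.ne_iff.1 h0
        refine Finset.sum_pos' (fun j _ => sq_nonneg _) ⟨i, Finset.mem_univ i, ?_⟩
        have : d i ≠ 0 := fun h => hi (by simp [ha, hd, h])
        positivity
      omega
    · have h8 := eight_le_golay_weight hb hc
      have : (wordWeight (fun i => (b i : ZMod 2)) : ℤ) ≤ ∑ i, b i ^ 2 := by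
        rw [wordWeight_eq_sum]
        refine Finset.sum_le_sum fun i _ => ?_
        split_ifs with h
        · positivity
        · have : b i ≠ 0 := fun h' => h (by simp [h'])
          have : 0 < b i ^ 2 := by positivity
          omega
      omega
  · by_cases hp : ∃ p, 9 ≤ a p ^ 2
    · obtain ⟨p, hp⟩ := hp
      have h1 : ∀ i, 1 ≤ a i ^ 2 := fun i => by
        rw [ha]
        rcases odd_sq_cases (b i) with h | h <;> omega
      rw [← Finset.add_sum_erase _ _ (Finset.mem_univ p)]
      have : ∑ i ∈ Finset.univ.erase p, (1 : ℤ) ≤ ∑ i ∈ Finset.univ.erase p, a i ^ 2 :=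
        Finset.sum_le_sum fun i _ => h1 i
      rw [Finset.sum_const, card_erase_univ, nsmul_eq_mul, Nat.cast_ofNat] at this
      linarith
    · push Not at hp
      -- If all entries are `±1`, their sum is `24 - 2 w` with `4 ∣ w`, hence `0` and not `4` modulo
      -- `8`.
      exfalso
      have : ∑ i, a i = 24 - 2 * wordWeight (fun i => (b i : ZMod 2)) := by
        rw [← sum_bitSign]
        refine Finset.sum_congr rfl fun i _ => ?_
        have := hp i
        rw [ha] at this ⊢
        exact bitSign_cast_eq ((odd_sq_cases (b i)).resolve_right (not_le.2 this))
      have h4 := four_dvd_golay_weight hb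
      have := hs.dvd
      omega

/-- A vector of shape `(∓3, ±1²³)`. -/
def oddVec (x : (Fin 24 → ZMod 2) × Fin 24) (i : Fin 24) : ℤ :=
  if i = x.2 then -3 * bitSign (x.1 i) else bitSign (x.1 i)

/-- A vector of shape `(±2⁸, 0¹⁶)`. -/
def evenVec (x : (_ : Fin 24 → ZMod 2) × Finset (Fin 24)) (i : Fin 24) : ℤ :=
  if x.1 i = 0 then 0 else if i ∈ x.2 then -2 else 2

theorem bitSign_sq (z : ZMod 2) : bitSign z ^ 2 = 1 := by
  unfold bitSign
  split_ifs <;> rfl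

theorem bitSign_eq (z : ZMod 2) : bitSign z = 1 ∨ bitSign z = -1 := sq_eq_one_iff.1 (bitSign_sq z)

theorem bitSign_eq_one {z : ZMod 2} : bitSign z = 1 ↔ z = 0 := by
  unfold bitSign
  split_ifs <;> simp_all

theorem bitSign_eq_neg_one {z : ZMod 2} : bitSign z = -1 ↔ z = 1 := by
  revert z
  decide

/-- Replacing one sign `s` by `-3 s` changes `b` by an even number, so the codeword stays, and it
moves the sum from `0` to `4` modulo `8`. -/
theorem isLeechVec_oddVec {c : Fin 24 → ZMod 2} (hc : c ∈ golayCode) (p : Fin 24) :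
    IsLeechVec (oddVec (c, p)) := by
  have hz : ∀ z : ZMod 2, (((bitSign z - 1) / 2 : ℤ) : ZMod 2) = z ∧
      bitSign z = 1 + 2 * ((bitSign z - 1) / 2) := by decide
  refine isLeechVec_iff.2 (Or.inr ⟨fun i => (bitSign (c i) - 1) / 2 -
    if i = p then 2 * bitSign (c i) else 0, fun i => ?_, ?_, ?_⟩)
  · have := (hz (c i)).2
    simp only [oddVec]
    split_ifs <;> linarith
  · convert hc using 1
    ext i
    have h2 : (2 : ZMod 2) = 0 := rfl
    push_cast
    rw [(hz (c i)).1]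
    split_ifs <;> simp [h2]
  · have : ∑ i, oddVec (c, p) i = ∑ i, bitSign (c i) - 4 * bitSign (c p) := by
      rw [← Finset.add_sum_erase _ _ (Finset.mem_univ p),
        ← Finset.add_sum_erase _ (fun i => bitSign (c i)) (Finset.mem_univ p),
        Finset.sum_congr rfl (g := fun i => bitSign (c i))]
      · simp only [oddVec, if_true]
        ring
      · intro i hi
        simp [oddVec, Finset.ne_of_mem_erase hi]
    rw [this, sum_bitSign, Int.modEq_iff_dvd]
    have h4 := four_dvd_golay_weight hc
    rcases bitSign_eq (c p) with h | h <;> rw [h] <;> omega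

theorem sum_sq_oddVec (c : Fin 24 → ZMod 2) (p : Fin 24) : ∑ i, oddVec (c, p) i ^ 2 = 32 := by
  rw [← Finset.add_sum_erase _ _ (Finset.mem_univ p), Finset.sum_congr rfl (g := fun _ => (1 : ℤ))]
  · simp [oddVec, mul_pow, bitSign_sq]
  · intro i hi
    simp [oddVec, Finset.ne_of_mem_erase hi, bitSign_sq]

/-- The equality case `32 = 9 + 23` of the norm bound: one entry is `±3` and no slack is left for
the others. -/
theorem exists_eq_oddVec {a b : Fin 24 → ℤ} (ha : ∀ i, a i = 1 + 2 * b i)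
    (hs : ∑ i, a i ^ 2 = 32) : ∃ p, a = oddVec (fun i => (b i : ZMod 2), p) := by
  have hp : ∃ p, a p ^ 2 ≠ 1 := by
    by_contra! h
    simp [h] at hs
  obtain ⟨p, hp⟩ := hp
  have h9 : 9 ≤ a p ^ 2 := by
    rw [ha] at hp ⊢
    exact (odd_sq_cases _).resolve_left hp
  rw [← Finset.add_sum_erase _ _ (Finset.mem_univ p)] at hs
  have h1 : ∀ i, 0 ≤ a i ^ 2 - 1 := fun i => by
    rw [ha]
    rcases odd_sq_cases (b i) with h | h <;> omega
  have hs2 : ∑ i ∈ Finset.univ.erase p, (a i ^ 2 - 1) = 9 - a p ^ 2 := by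
    rw [Finset.sum_sub_distrib, Finset.sum_const, card_erase_univ, nsmul_eq_mul, Nat.cast_ofNat]
    linarith
  have h0 : ∑ i ∈ Finset.univ.erase p, (a i ^ 2 - 1) = 0 :=
    le_antisymm (by linarith) (Finset.sum_nonneg fun i _ => h1 i)
  have hi := (Finset.sum_eq_zero_iff_of_nonneg fun i _ => h1 i).1 h0
  refine ⟨p, funext fun i => ?_⟩
  simp only [oddVec]
  split_ifs with h
  · subst h
    have : a i ^ 2 = 9 := by linarith
    rw [ha] at this ⊢
    exact neg_three_bitSign_cast_eq this
  · have : a i ^ 2 = 1 := by linarith [hi i (by simp [h])]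
    rw [ha] at this ⊢
    exact bitSign_cast_eq this

theorem sum_evenVec {c : Fin 24 → ZMod 2} {N : Finset (Fin 24)} (hN : ∀ i ∈ N, c i ≠ 0) :
    ∑ i, evenVec ⟨c, N⟩ i = 2 * wordWeight c - 4 * N.card := by
  have : (N.card : ℤ) = ∑ i, if i ∈ N then 1 else 0 := by simp
  rw [wordWeight_eq_sum, this, Finset.mul_sum, Finset.mul_sum, ← Finset.sum_sub_distrib]
  refine Finset.sum_congr rfl fun i _ => ?_
  simp only [evenVec]
  split_ifs with h1 h2 h2 <;> first | rfl | exact absurd h1 (hN i h2)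

theorem sum_sq_evenVec (c : Fin 24 → ZMod 2) (N : Finset (Fin 24)) :
    ∑ i, evenVec ⟨c, N⟩ i ^ 2 = 4 * wordWeight c := by
  rw [wordWeight_eq_sum, Finset.mul_sum]
  refine Finset.sum_congr rfl fun i _ => ?_
  simp only [evenVec]
  split_ifs <;> rfl

theorem isLeechVec_evenVec {c : Fin 24 → ZMod 2} (hc : c ∈ golayCode) {N : Finset (Fin 24)}
    (hN : ∀ i ∈ N, c i ≠ 0) (hN2 : Even N.card) : IsLeechVec (evenVec ⟨c, N⟩) := by
  have h2 : ∀ i, evenVec ⟨c, N⟩ i = 2 * (evenVec ⟨c, N⟩ i / 2) := fun i => by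
    simp only [evenVec]
    split_ifs <;> rfl
  refine isLeechVec_iff.2 (Or.inl ⟨fun i => evenVec ⟨c, N⟩ i / 2, h2, ?_, ?_⟩)
  · convert hc using 1
    ext i
    have h1 : ∀ z : ZMod 2, z ≠ 0 → z = 1 := by decide
    simp only [evenVec]
    split_ifs with h h'
    · simp [h]
    · rw [h1 _ h]; rfl
    · rw [h1 _ h]; rfl
  · have h4 := four_dvd_golay_weight hc
    have hs := sum_evenVec hN
    rw [Finset.sum_congr rfl fun i _ => h2 i, ← Finset.mul_sum] at hs
    obtain ⟨k, hk⟩ := hN2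
    change 4 ∣ ∑ i, evenVec ⟨c, N⟩ i / 2
    omega

/-- Equality in `8 = ∑ b² ≥ weight ≥ 8` makes the nonzero `b i` equal to `±1` on an octad. With `N`
the set of minus signs, `∑ b = 8 - 2 |N|`, so `4 ∣ ∑ b` says that `|N|` is even. -/
theorem exists_eq_evenVec {a b : Fin 24 → ℤ} (ha : ∀ i, a i = 2 * b i)
    (hb : (fun i => (b i : ZMod 2)) ∈ golayCode) (hb0 : (fun i => (b i : ZMod 2)) ≠ 0)
    (h4 : 4 ∣ ∑ i, b i) (hs : ∑ i, a i ^ 2 = 32) :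
    wordWeight (fun i => (b i : ZMod 2)) = 8 ∧ ∃ N : Finset (Fin 24),
      (∀ i ∈ N, (b i : ZMod 2) ≠ 0) ∧ Even N.card ∧
      a = evenVec ⟨fun i => (b i : ZMod 2), N⟩ := by
  set c : Fin 24 → ZMod 2 := fun i => (b i : ZMod 2) with hc
  have h8 := eight_le_golay_weight hb hb0
  have hs' : ∑ i, b i ^ 2 = 8 := by
    rw [Finset.sum_congr rfl fun i _ => show a i ^ 2 = 4 * b i ^ 2 by rw [ha]; ring,
      ← Finset.mul_sum] at hs
    linarith
  have h1 : ∀ i, 0 ≤ b i ^ 2 - (if c i = 0 then 0 else 1 : ℤ) := fun i => by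
    split_ifs with h
    · simpa using sq_nonneg (b i)
    · have : b i ≠ 0 := fun h' => h (by simp [hc, h'])
      have : 0 < b i ^ 2 := by positivity
      omega
  have hw := wordWeight_eq_sum c
  have hsum : ∑ i, (b i ^ 2 - (if c i = 0 then 0 else 1 : ℤ)) = 8 - wordWeight c := by
    rw [Finset.sum_sub_distrib, ← hw, hs']
  have h0 : ∑ i, (b i ^ 2 - (if c i = 0 then 0 else 1 : ℤ)) = 0 :=
    le_antisymm (by rw [hsum]; omega) (Finset.sum_nonneg fun i _ => h1 i)
  have hi := (Finset.sum_eq_zero_iff_of_nonneg fun i _ => h1 i).1 h0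
  have hN : ∀ i ∈ Finset.univ.filter (fun i => b i = -1), c i ≠ 0 := by
    intro i hi
    simp only [Finset.mem_filter, Finset.mem_univ, true_and] at hi
    simp [hc, hi]
  have hae : a = evenVec ⟨c, Finset.univ.filter fun i => b i = -1⟩ := by
    ext i
    have := hi i (Finset.mem_univ i)
    simp only [evenVec, Finset.mem_filter, Finset.mem_univ, true_and]
    rw [ha]
    by_cases h : c i = 0
    · have h0 : b i = 0 := by simpa [h] using this
      simp [h, h0]
    · rw [if_neg h, sub_eq_zero] at this
      rcases sq_eq_one_iff.1 this with h' | h' <;> simp [h, h']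
  have hw8 : wordWeight c = 8 := by omega
  refine ⟨hw8, _, hN, ?_, hae⟩
  have he := sum_evenVec hN
  rw [← hae, Finset.sum_congr rfl fun i _ => ha i, ← Finset.mul_sum, hw8] at he
  rw [even_iff_two_dvd]
  omega

end Leech

/-! ### Counting minimal vectors with a prescribed beginning -/

section Counting

theorem card_powerset_filter_even (T : Finset (Fin 24)) :
    (T.powerset.filter fun N => Even N.card).card =
      ∑ m ∈ Finset.range (T.card + 1), T.card.choose m * if Even m then 1 else 0 := by
  rw [Finset.card_filter, Finset.sum_powerset_apply_card (fun m => if Even m then 1 else 0)]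
  simp only [smul_eq_mul]

/-- These are the even subsets of the remaining seven points, `2⁶` in number. -/
theorem card_even_avoiding {T : Finset (Fin 24)} {i : Fin 24} (hT : T.card = 8) (hi : i ∈ T) :
    (T.powerset.filter fun N => Even N.card ∧ i ∉ N).card = 64 := by
  have e : (T.powerset.filter fun N => Even N.card ∧ i ∉ N) =
      ((T.erase i).powerset.filter fun N => Even N.card) := by
    ext N
    simp only [Finset.mem_filter, Finset.mem_powerset, Finset.subset_erase]
    tauto
  rw [e, card_powerset_filter_even, Finset.card_erase_of_mem hi, hT]
  decide

/-- Removing `j` and `k` preserves parity and leaves the even subsets of a 6-set, `2⁵` in number. -/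
theorem card_even_containing {T : Finset (Fin 24)} {j k : Fin 24} (hT : T.card = 8) (hj : j ∈ T)
    (hk : k ∈ T) (hjk : j ≠ k) :
    (T.powerset.filter fun N => Even N.card ∧ j ∈ N ∧ k ∈ N).card = 32 := by
  have hcard : ((T.erase j).erase k).card = 6 := by
    rw [Finset.card_erase_of_mem (Finset.mem_erase.2 ⟨hjk.symm, hk⟩), Finset.card_erase_of_mem hj, hT]
  have h32 := card_powerset_filter_even ((T.erase j).erase k)
  rw [hcard] at h32
  refine Eq.trans ?_ (h32.trans (by decide))
  symm
  refine Finset.card_bij' (fun N _ => insert j (insert k N)) (fun N _ => (N.erase j).erase k)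
    ?_ ?_ ?_ ?_
  · intro N hN
    simp only [Finset.mem_filter, Finset.mem_powerset, Finset.subset_erase] at hN ⊢
    obtain ⟨⟨⟨hNT, hjN⟩, hkN⟩, he⟩ := hN
    refine ⟨Finset.insert_subset hj (Finset.insert_subset hk hNT), ?_, by simp, by simp⟩
    rw [Finset.card_insert_of_notMem (by simp [hjk, hjN]), Finset.card_insert_of_notMem hkN,
      add_assoc]
    exact he.add (by decide)
  · intro N hN
    simp only [Finset.mem_filter, Finset.mem_powerset] at hN ⊢
    obtain ⟨hNT, he, hjN, hkN⟩ := hN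
    refine ⟨Finset.erase_subset_erase _ (Finset.erase_subset_erase _ hNT), ?_⟩
    have hk' : k ∈ N.erase j := Finset.mem_erase.2 ⟨hjk.symm, hkN⟩
    have h1 := Finset.card_erase_add_one hk'
    have h2 := Finset.card_erase_add_one hjN
    rw [← h2, ← h1, add_assoc] at he
    exact (Nat.even_add.1 he).2 (by decide)
  · intro N hN
    simp only [Finset.mem_filter, Finset.mem_powerset, Finset.subset_erase] at hN
    obtain ⟨⟨⟨hNT, hjN⟩, hkN⟩, he⟩ := hN
    rw [Finset.erase_insert (by simp [hjk, hjN]), Finset.erase_insert hkN]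
  · intro N hN
    simp only [Finset.mem_filter, Finset.mem_powerset] at hN
    obtain ⟨hNT, he, hjN, hkN⟩ := hN
    rw [Finset.insert_erase (Finset.mem_erase.2 ⟨hjk.symm, hkN⟩), Finset.insert_erase hjN]

/-- The support of a word. -/
def wordSupport (c : Fin 24 → ZMod 2) : Finset (Fin 24) := Finset.univ.filter fun i => c i ≠ 0

theorem mem_wordSupport {c : Fin 24 → ZMod 2} {i : Fin 24} : i ∈ wordSupport c ↔ c i ≠ 0 := by
  simp [wordSupport]

/-- The minimal vectors of the Leech lattice whose coordinates at `i`, `j`, `k` are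
`t + 2`, `t`, `t`. -/
def startMinVecs (i j k : Fin 24) : Set (Fin 24 → ℤ) :=
  {a | IsLeechVec a ∧ ∑ l, a l ^ 2 = 32 ∧ a i - a j = 2 ∧ a j = a k}

/-- The parameters of the odd vectors in `startMinVecs i j k`. -/
def startOdd (i j k : Fin 24) : Finset ((Fin 24 → ZMod 2) × Fin 24) :=
  (Finset.univ.filter fun c => c ∈ golayCode ∧ (c i = 1 ∧ c j = 0 ∧ c k = 0)) ×ˢ {i} ∪
  (Finset.univ.filter fun c => c ∈ golayCode ∧ (c i = 0 ∧ c j = 1 ∧ c k = 1)) ×ˢ {i, j, k}ᶜ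

/-- The parameters of the even vectors in `startMinVecs i j k`. -/
def startEven (i j k : Fin 24) : Finset ((_ : Fin 24 → ZMod 2) × Finset (Fin 24)) :=
  ((Finset.univ.filter fun c => c ∈ golayCode ∧
      ((c i = 1 ∧ c j = 0 ∧ c k = 0) ∧ wordWeight c = 8)).sigma fun c =>
    (wordSupport c).powerset.filter fun N => Even N.card ∧ i ∉ N) ∪
  ((Finset.univ.filter fun c => c ∈ golayCode ∧
      ((c i = 0 ∧ c j = 1 ∧ c k = 1) ∧ wordWeight c = 8)).sigma fun c =>
    (wordSupport c).powerset.filter fun N => Even N.card ∧ j ∈ N ∧ k ∈ N)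

theorem card_startOdd {i j k : Fin 24} (h : StartCounts i j k) (hij : i ≠ j) (hik : i ≠ k)
    (hjk : j ≠ k) : (startOdd i j k).card = 11264 := by
  obtain ⟨h1, h2, -, -⟩ := h.card_golay
  rw [startOdd, Finset.card_union_of_disjoint, Finset.card_product, Finset.card_product, h1, h2,
    Finset.card_compl, Finset.card_eq_three.2 ⟨i, j, k, hij, hik, hjk, rfl⟩,
    Finset.card_singleton, Fintype.card_fin]
  · rw [Finset.disjoint_left]
    rintro ⟨c, p⟩ hx hx'
    simp only [Finset.mem_product, Finset.mem_filter] at hx hx'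
    exact one_ne_zero (hx.1.2.2.1.symm.trans hx'.1.2.2.1)

theorem card_startEven {i j k : Fin 24} (h : StartCounts i j k) (hjk : j ≠ k) :
    (startEven i j k).card = 9472 := by
  obtain ⟨-, -, h3, h4⟩ := h.card_golay
  rw [startEven, Finset.card_union_of_disjoint, Finset.card_sigma, Finset.card_sigma,
    Finset.sum_congr rfl (g := fun _ => 64), Finset.sum_const, h3,
    Finset.sum_congr rfl (g := fun _ => 32), Finset.sum_const, h4]
  · rfl
  · intro c hc
    simp only [Finset.mem_filter] at hc
    exact card_even_containing hc.2.2.2 (mem_wordSupport.2 (by simp [hc.2.2.1]))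
      (mem_wordSupport.2 (by simp [hc.2.2.1])) hjk
  · intro c hc
    simp only [Finset.mem_filter] at hc
    exact card_even_avoiding hc.2.2.2 (mem_wordSupport.2 (by simp [hc.2.2.1]))
  · rw [Finset.disjoint_left]
    rintro ⟨c, p⟩ hx hx'
    simp only [Finset.mem_sigma, Finset.mem_filter] at hx hx'
    exact one_ne_zero (hx.1.2.2.1.1.symm.trans hx'.1.2.2.1.1)

theorem bitSign_injective : Function.Injective bitSign := by decide

/-- The entry of absolute value `3` reveals the position, the signs reveal the codeword. -/
theorem oddVec_injective : Function.Injective oddVec := by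
  rintro ⟨c, p⟩ ⟨c', p'⟩ h
  have hp : p = p' := by
    by_contra hne
    have := congrFun h p
    simp only [oddVec, if_true, if_neg hne] at this
    have h1 := bitSign_eq (c p)
    have h2 := bitSign_eq (c' p)
    omega
  subst hp
  refine Prod.ext (funext fun i => bitSign_injective ?_) rfl
  have := congrFun h i
  simp only [oddVec] at this
  split_ifs at this
  · dsimp only at this ⊢
    omega
  · exact this

theorem evenVec_injOn : Set.InjOn evenVec {x | x.2 ⊆ wordSupport x.1} := by
  rintro ⟨c, N⟩ hN ⟨c', N'⟩ hN' h
  simp only [Set.mem_ofPred_eq] at hN hN'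
  have hz : ∀ i, evenVec ⟨c, N⟩ i = 0 ↔ c i = 0 := fun i => by
    simp only [evenVec]
    split_ifs <;> simp_all
  have hz' : ∀ i, evenVec ⟨c', N'⟩ i = 0 ↔ c' i = 0 := fun i => by
    simp only [evenVec]
    split_ifs <;> simp_all
  have hm : ∀ i, evenVec ⟨c, N⟩ i = -2 ↔ i ∈ N := fun i => by
    have := @hN i
    rw [mem_wordSupport] at this
    simp only [evenVec]
    split_ifs <;> simp_all
  have hm' : ∀ i, evenVec ⟨c', N'⟩ i = -2 ↔ i ∈ N' := fun i => by
    have := @hN' i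
    rw [mem_wordSupport] at this
    simp only [evenVec]
    split_ifs <;> simp_all
  have key : ∀ x y : ZMod 2, (x = 0 ↔ y = 0) → x = y := by decide
  have hc : c = c' := funext fun i => key _ _ (by rw [← hz, ← hz', h])
  have hN2 : N = N' := Finset.ext fun i => by rw [← hm, ← hm', h]
  rw [hc, hN2]

/-- Among `±1` and one `∓3`, a beginning `t + 2, t, t` is either `3, 1, 1` or `1, -1, -1`; these are
the two parts of `startOdd`. -/
theorem oddVec_mem_startMinVecs {i j k : Fin 24} (hij : i ≠ j) (hik : i ≠ k) (hjk : j ≠ k)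
    {x : (Fin 24 → ZMod 2) × Fin 24} (hc : x.1 ∈ golayCode) :
    oddVec x ∈ startMinVecs i j k ↔ x ∈ startOdd i j k := by
  obtain ⟨c, p⟩ := x
  simp only [startMinVecs, Set.mem_ofPred_eq, isLeechVec_oddVec hc, sum_sq_oddVec, true_and,
    startOdd, Finset.mem_union, Finset.mem_product, Finset.mem_filter, Finset.mem_univ,
    show c ∈ golayCode from hc, Finset.mem_singleton, Finset.mem_compl, Finset.mem_insert, not_or]
  rw [← bitSign_eq_one (z := c i), ← bitSign_eq_one (z := c j), ← bitSign_eq_one (z := c k),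
    ← bitSign_eq_neg_one (z := c i), ← bitSign_eq_neg_one (z := c j),
    ← bitSign_eq_neg_one (z := c k)]
  have h1 := bitSign_eq (c i)
  have h2 := bitSign_eq (c j)
  have h3 := bitSign_eq (c k)
  simp only [oddVec]
  generalize bitSign (c i) = x at *
  generalize bitSign (c j) = y at *
  generalize bitSign (c k) = z at *
  split_ifs <;> omega

/-- With entries `0, ±2`, a beginning `t + 2, t, t` is either `2, 0, 0` or `0, -2, -2`; these are
the two parts of `startEven`. -/
theorem evenVec_mem_startMinVecs {i j k : Fin 24} {x : (_ : Fin 24 → ZMod 2) × Finset (Fin 24)}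
    (hc : x.1 ∈ golayCode) (hw : wordWeight x.1 = 8) (hN : x.2 ⊆ wordSupport x.1)
    (he : Even x.2.card) :
    evenVec x ∈ startMinVecs i j k ↔ x ∈ startEven i j k := by
  obtain ⟨c, N⟩ := x
  simp only at hc hw hN he
  have hN' : ∀ i ∈ N, c i ≠ 0 := fun i hi => mem_wordSupport.1 (hN hi)
  simp only [startMinVecs, Set.mem_ofPred_eq, isLeechVec_evenVec hc hN' he, sum_sq_evenVec, true_and,
    startEven, Finset.mem_union, Finset.mem_sigma, Finset.mem_filter, Finset.mem_univ, hc, hw,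
    Finset.mem_powerset, hN, he, and_true]
  have h0 : ∀ z : ZMod 2, z = 1 ↔ z ≠ 0 := by decide
  have hi := hN' i
  have hj := hN' j
  have hk := hN' k
  simp only [evenVec, h0]
  by_cases ci : c i = 0 <;> by_cases cj : c j = 0 <;> by_cases ck : c k = 0 <;>
    by_cases ni : i ∈ N <;> by_cases nj : j ∈ N <;> by_cases nk : k ∈ N <;>
    simp_all

theorem ncard_startMinVecs {i j k : Fin 24} (h : StartCounts i j k) (hij : i ≠ j) (hik : i ≠ k)
    (hjk : j ≠ k) : (startMinVecs i j k).ncard = 20736 := by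
  classical
  have hodd : ∀ x ∈ startOdd i j k, x.1 ∈ golayCode := by
    intro x hx
    simp only [startOdd, Finset.mem_union, Finset.mem_product, Finset.mem_filter] at hx
    tauto
  have heven : ∀ x ∈ startEven i j k, x.1 ∈ golayCode ∧ wordWeight x.1 = 8 ∧
      x.2 ⊆ wordSupport x.1 ∧ Even x.2.card := by
    intro x hx
    simp only [startEven, Finset.mem_union, Finset.mem_sigma, Finset.mem_filter,
      Finset.mem_powerset] at hx
    tauto
  have e : startMinVecs i j k =
      ((startOdd i j k).image oddVec ∪ (startEven i j k).image evenVec : Finset _) := by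
    ext a
    simp only [Finset.coe_union, Finset.coe_image, Set.mem_union, Set.mem_image, SetLike.mem_coe]
    constructor
    · intro ha
      have ha' := ha
      obtain ⟨hL, hs, hij', hjk'⟩ := ha
      rcases isLeechVec_iff.1 hL with ⟨b, hab, hb, h4⟩ | ⟨b, hab, hb, h4⟩
      · right
        -- The shape `(±4², 0²²)` does not occur, because two coordinates differ by `2`.
        have hb0 : (fun i => (b i : ZMod 2)) ≠ 0 := by
          intro h0
          have h1 := intCast_zmod_two_eq_zero.1 (congrFun h0 i)
          have h2 := intCast_zmod_two_eq_zero.1 (congrFun h0 j)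
          rw [hab, hab] at hij'
          omega
        obtain ⟨hw, N, hN, he, rfl⟩ := exists_eq_evenVec hab hb hb0 h4 hs
        exact ⟨_, (evenVec_mem_startMinVecs hb hw
          (fun i hi => mem_wordSupport.2 (hN i hi)) he).1 ha', rfl⟩
      · left
        obtain ⟨p, rfl⟩ := exists_eq_oddVec hab hs
        exact ⟨_, (oddVec_mem_startMinVecs hij hik hjk hb).1 ha', rfl⟩
    · rintro (⟨x, hx, rfl⟩ | ⟨x, hx, rfl⟩)
      · exact (oddVec_mem_startMinVecs hij hik hjk (hodd x hx)).2 hx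
      · obtain ⟨h1, h2, h3, h4⟩ := heven x hx
        exact (evenVec_mem_startMinVecs h1 h2 h3 h4).2 hx
  rw [e, Set.ncard_coe_finset, Finset.card_union_of_disjoint,
    Finset.card_image_of_injective _ oddVec_injective,
    Finset.card_image_of_injOn (evenVec_injOn.mono fun x hx => (heven x hx).2.2.1),
    card_startOdd h hij hik hjk, card_startEven h hjk]
  rw [Finset.disjoint_left]
  rintro a ha hb
  obtain ⟨x, -, rfl⟩ := Finset.mem_image.1 ha
  obtain ⟨y, -, h⟩ := Finset.mem_image.1 hb
  have h0 := congrFun h 0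
  simp only [oddVec, evenVec] at h0
  have := bitSign_eq (x.1 0)
  split_ifs at h0 <;> omega

end Counting

/-! ### A basis and the determinant of `Λ₂₂` -/

section Laminated

/-- The coordinates that determine a vector beginning with three equal coordinates, in an order
for which `lamBasis` is triangular. -/
def lamCoord : Fin 22 → Fin 24 :=
  ![0, 3, 4, 5, 6, 8, 9, 10, 12, 16, 7, 11, 13, 14, 15, 17, 18, 19, 20, 21, 22, 23]

/-- A basis of `√8 Λ₂₂`. -/
def lamBasis (i : Fin 22) (k : Fin 24) : ℤ :=
  if i = 0 then (if k = 23 then -3 else 1)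
  else if i < 10 then (if (golayMasks.getD (i + 2) 0).testBit k then 2 else 0)
  else if i = 21 then (if k = 23 then 8 else 0)
  else if k = lamCoord i then 4 else if k = 23 then -4 else 0

theorem lamBasis_equal (i : Fin 22) : lamBasis i 0 = lamBasis i 1 ∧ lamBasis i 1 = lamBasis i 2 := by
  revert i
  decide +kernel

theorem isLeechVec_lamBasis (i : Fin 22) : IsLeechVec (lamBasis i) := by
  rw [isLeechVec_iff]
  by_cases hi : i = 0
  · subst hi
    refine Or.inr ⟨fun k => (lamBasis 0 k - 1) / 2, ?_, ?_, ?_⟩ <;> decide +kernel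
  · have h : ∀ i : Fin 22, i ≠ 0 → (∀ k, lamBasis i k = 2 * (lamBasis i k / 2)) ∧
        (fun k => ((lamBasis i k / 2 : ℤ) : ZMod 2)) ∈ golayCode ∧
        4 ∣ ∑ k, lamBasis i k / 2 := by
      decide +kernel
    exact Or.inl ⟨_, h i hi⟩

theorem lamBasis_codewords : ∀ j ∈ Finset.Icc (1 : Fin 22) 9, ∀ i ∈ Finset.Icc (1 : Fin 22) 9,
    lamBasis i (lamCoord j) = if j = i then 2 else 0 := by
  decide +kernel

/-- For `k` off the pivots, `4 e_k - 4 e_23` is a basis vector, or zero when `k = 23`. -/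
theorem mem_golayPivots_or (k : Fin 24) : k ∈ golayPivots ∨
    ∃ i, lamBasis i + Pi.single 23 4 = Pi.single k 4 ∨
      Pi.single k 4 - Pi.single 23 4 = (0 : Fin 24 → ℤ) := by
  revert k
  decide +kernel

theorem IsLeechVec.add {a b : Fin 24 → ℤ} (ha : IsLeechVec a) (hb : IsLeechVec b) :
    IsLeechVec (a + b) := by
  rw [← scaledVec_mem_leechLattice] at *
  rw [map_add]
  exact add_mem ha hb

theorem IsLeechVec.zsmul {a : Fin 24 → ℤ} (n : ℤ) (ha : IsLeechVec a) : IsLeechVec (n • a) := by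
  rw [← scaledVec_mem_leechLattice] at *
  rw [map_zsmul]
  exact zsmul_mem ha n

theorem IsLeechVec.neg {a : Fin 24 → ℤ} (ha : IsLeechVec a) : IsLeechVec (-a) := by
  simpa using ha.zsmul (-1)

theorem IsLeechVec.sub {a b : Fin 24 → ℤ} (ha : IsLeechVec a) (hb : IsLeechVec b) :
    IsLeechVec (a - b) := by
  rw [sub_eq_add_neg]
  exact ha.add hb.neg

theorem zsmul_lamBasis_mem_span (i : Fin 22) (n : ℤ) :
    n • lamBasis i ∈ Submodule.span ℤ (Set.range lamBasis) :=
  Submodule.smul_mem _ n (Submodule.subset_span (Set.mem_range_self i))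

theorem mem_span_lamBasis_of_pivots {a : Fin 24 → ℤ} (ha : IsLeechVec a)
    (h0 : ∀ k ∈ golayPivots, a k = 0) : a ∈ Submodule.span ℤ (Set.range lamBasis) := by
  rcases isLeechVec_iff.1 ha with ⟨b, hab, hb, hs⟩ | ⟨b, hab, -⟩
  · have hc : (fun i => (b i : ZMod 2)) = 0 := golay_ext hb fun k hk => by
      have := h0 k hk
      rw [hab] at this
      simp [show b k = 0 by omega]
    have hd : ∀ i, ∃ d, b i = 2 * d := fun i => intCast_zmod_two_eq_zero.1 (congrFun hc i)
    choose d hd using hd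
    have hsum : ∑ i, b i = 2 * ∑ i, d i := by
      rw [Finset.mul_sum]
      exact Finset.sum_congr rfl fun i _ => hd i
    obtain ⟨e, he⟩ : 2 ∣ ∑ i, d i := by omega
    -- Here `a = 4 d` with `∑ d = 2 e`; moving all entries to the last coordinate leaves `4 · 2 e`
    -- there.
    have hae : a = ∑ k, d k • (Pi.single k 4 - Pi.single 23 4 : Fin 24 → ℤ) + e • lamBasis 21 := by
      have h21 : lamBasis 21 = Pi.single 23 8 := by decide +kernel
      rw [h21]
      ext l
      simp only [Pi.add_apply, Finset.sum_apply, Pi.smul_apply, Pi.sub_apply, smul_eq_mul, mul_sub,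
        Finset.sum_sub_distrib, ← Finset.sum_mul, he]
      have : ∑ k, d k * (Pi.single k 4 : Fin 24 → ℤ) l = 4 * d l := by
        simp [Pi.single_apply, mul_comm]
      rw [this, hab, hd]
      by_cases hl : l = 23
      · subst hl
        simp
        ring
      · simp [Pi.single_eq_of_ne hl]
        ring
    rw [hae]
    refine add_mem (sum_mem fun k _ => ?_) (zsmul_lamBasis_mem_span 21 e)
    rcases mem_golayPivots_or k with hk | ⟨i, hi | hi⟩
    · have := h0 k hk
      rw [hab, hd] at this
      rw [show d k = 0 by omega, zero_smul]
      exact zero_mem _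
    · rw [← hi, add_sub_cancel_right]
      exact zsmul_lamBasis_mem_span i _
    · rw [hi, smul_zero]
      exact zero_mem _
  · have := h0 0 (by decide)
    rw [hab] at this
    omega

/-- Elimination in the triangular order: the odd basis vector clears the three equal coordinates,
doubled codewords clear the other pivots, and the rest is handled by `mem_span_lamBasis_of_pivots`.
-/
theorem mem_span_lamBasis {a : Fin 24 → ℤ} (ha : IsLeechVec a) (h01 : a 0 = a 1)
    (h12 : a 1 = a 2) : a ∈ Submodule.span ℤ (Set.range lamBasis) := by
  have h1 := ha.sub ((isLeechVec_lamBasis 0).zsmul (a 0))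
  rw [← sub_add_cancel a (a 0 • lamBasis 0)]
  refine add_mem ?_ (zsmul_lamBasis_mem_span _ _)
  have z0 : (a - a 0 • lamBasis 0) 0 = 0 := by
    simp [show lamBasis 0 0 = 1 from rfl]
  have z1 : (a - a 0 • lamBasis 0) 1 = 0 := by
    simp [show lamBasis 0 1 = 1 from rfl, h01]
  have z2 : (a - a 0 • lamBasis 0) 2 = 0 := by
    simp [show lamBasis 0 2 = 1 from rfl, h01, h12]
  generalize a - a 0 • lamBasis 0 = a' at *
  rcases isLeechVec_iff.1 h1 with ⟨b, hab, -⟩ | ⟨b, hab, -⟩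
  · set t : Fin 24 → ℤ := ∑ i ∈ Finset.Icc (1 : Fin 22) 9, b (lamCoord i) • lamBasis i with ht
    have htS : t ∈ Submodule.span ℤ (Set.range lamBasis) := sum_mem fun i _ => zsmul_lamBasis_mem_span _ _
    have htL : IsLeechVec t := by
      rw [← scaledVec_mem_leechLattice, ht, map_sum]
      refine sum_mem fun i _ => ?_
      rw [map_zsmul]
      exact zsmul_mem (scaledVec_mem_leechLattice.2 (isLeechVec_lamBasis i)) _
    rw [← sub_add_cancel a' t]
    refine add_mem (mem_span_lamBasis_of_pivots (h1.sub htL) ?_) htS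
    have hz : ∀ i ∈ Finset.Icc (1 : Fin 22) 9, lamBasis i 0 = 0 ∧ lamBasis i 1 = 0 ∧
        lamBasis i 2 = 0 := by decide +kernel
    have ht' : ∀ k, t k = ∑ i ∈ Finset.Icc (1 : Fin 22) 9, b (lamCoord i) * lamBasis i k := by
      intro k
      simp [ht]
    have hpiv : ∀ k ∈ golayPivots, k = 0 ∨ k = 1 ∨ k = 2 ∨
        ∃ j ∈ Finset.Icc (1 : Fin 22) 9, k = lamCoord j := by decide +kernel
    intro k hk
    rw [Pi.sub_apply, ht']
    rcases hpiv k hk with rfl | rfl | rfl | ⟨j, hj, rfl⟩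
    · rw [Finset.sum_eq_zero fun i hi => by rw [(hz i hi).1, mul_zero], z0, sub_zero]
    · rw [Finset.sum_eq_zero fun i hi => by rw [(hz i hi).2.1, mul_zero], z1, sub_zero]
    · rw [Finset.sum_eq_zero fun i hi => by rw [(hz i hi).2.2, mul_zero], z2, sub_zero]
    · rw [Finset.sum_congr rfl fun i hi => by rw [lamBasis_codewords j hj i hi], hab]
      simp only [mul_ite, mul_zero, Finset.sum_ite_eq, if_pos hj]
      ring
  · have := hab 0
    omega

theorem mem_laminated22 {x : EuclideanSpace ℝ (Fin 24)} :
    x ∈ laminated22 ↔ ∃ a, IsLeechVec a ∧ (a 0 = a 1 ∧ a 1 = a 2) ∧ scaledVec a = x := by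
  have h : ∀ a : Fin 24 → ℤ, scaledVec a ∈ threeEqual ↔ a 0 = a 1 ∧ a 1 = a 2 := fun a => by
    have h8 : √8 ≠ 0 := by positivity
    change scaledVec a 0 = scaledVec a 1 ∧ scaledVec a 1 = scaledVec a 2 ↔ _
    simp [div_left_inj' h8]
  rw [laminated22, latticeSection, Submodule.mem_inf, mem_leechLattice_iff]
  constructor
  · rintro ⟨⟨a, ha, rfl⟩, h'⟩
    exact ⟨a, ha, (h a).1 h', rfl⟩
  · rintro ⟨a, ha, h', rfl⟩
    exact ⟨⟨a, ha, rfl⟩, (h a).2 h'⟩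

theorem span_scaledVec_lamBasis :
    Submodule.span ℤ (Set.range fun i => scaledVec (lamBasis i)) = laminated22 := by
  have e : (Set.range fun i => scaledVec (lamBasis i)) =
      scaledVec.toIntLinearMap '' Set.range lamBasis := by
    rw [← Set.range_comp]
    rfl
  rw [e, Submodule.span_image]
  apply le_antisymm
  · rw [Submodule.map_le_iff_le_comap, Submodule.span_le]
    rintro _ ⟨i, rfl⟩
    exact mem_laminated22.2 ⟨_, isLeechVec_lamBasis i, lamBasis_equal i, rfl⟩
  · intro x hx
    obtain ⟨a, ha, ⟨h1, h2⟩, rfl⟩ := mem_laminated22.1 hx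
    exact ⟨a, mem_span_lamBasis ha h1 h2, rfl⟩

theorem inner_scaledVec (a b : Fin 24 → ℤ) :
    inner ℝ (scaledVec a) (scaledVec b) = ((∑ i, a i * b i : ℤ) : ℝ) * (1 / 8) := by
  rw [PiLp.inner_apply]
  push_cast
  rw [Finset.sum_mul]
  refine Finset.sum_congr rfl fun i _ => ?_
  have h8 : √8 * √8 = 8 := Real.mul_self_sqrt (by norm_num)
  simp only [scaledVec_apply, RCLike.inner_apply, conj_trivial]
  rw [div_mul_div_comm, h8]
  ring

/-- The weights of the coordinates `lamCoord` in the inner product. -/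
def lamWeight (k : Fin 22) : ℤ := if k = 0 then 3 else 1

/-- Coordinate `0` stands for three equal ones, hence its weight `3`. -/
theorem sum_mul_eq_sum_lamCoord {a b : Fin 24 → ℤ} (ha : a 0 = a 1 ∧ a 1 = a 2)
    (hb : b 0 = b 1 ∧ b 1 = b 2) :
    ∑ i, a i * b i = ∑ k, a (lamCoord k) * lamWeight k * b (lamCoord k) := by
  have hinj : Function.Injective lamCoord := by decide +kernel
  have himg : Finset.univ.image lamCoord = ({1, 2} : Finset (Fin 24))ᶜ := by decide +kernel
  have h1 : ∑ k, a (lamCoord k) * b (lamCoord k) =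
      ∑ i ∈ ({1, 2} : Finset (Fin 24))ᶜ, a i * b i := by
    rw [← himg, Finset.sum_image hinj.injOn]
  have h2 : ∑ k, a (lamCoord k) * lamWeight k * b (lamCoord k) =
      ∑ k, a (lamCoord k) * b (lamCoord k) + 2 * (a 0 * b 0) := by
    rw [← Finset.add_sum_erase _ _ (Finset.mem_univ (0 : Fin 22)),
      ← Finset.add_sum_erase _ (fun k => a (lamCoord k) * b (lamCoord k))
        (Finset.mem_univ (0 : Fin 22)),
      Finset.sum_congr rfl (g := fun k => a (lamCoord k) * b (lamCoord k))]
    · rw [show lamCoord 0 = 0 from rfl, show lamWeight 0 = 3 from rfl]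
      ring
    · intro k hk
      rw [lamWeight, if_neg (Finset.ne_of_mem_erase hk), mul_one]
  rw [h2, h1, ← Finset.sum_add_sum_compl ({1, 2} : Finset (Fin 24)), Finset.sum_pair (by decide),
    ← ha.2, ← ha.1, ← hb.2, ← hb.1]
  ring

/-- The coordinates of `lamBasis` form a triangular matrix. -/
def lamMatrix : Matrix (Fin 22) (Fin 22) ℤ := Matrix.of fun i k => lamBasis i (lamCoord k)

/-- The diagonal consists of `1`, nine entries `2`, eleven entries `4`, and `8`. -/
theorem det_lamMatrix : lamMatrix.det = 2 ^ 34 := by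
  rw [Matrix.det_of_isUpperTriangular]
  · decide +kernel
  · intro i j hij
    have h : ∀ i j : Fin 22, j < i → lamBasis i (lamCoord j) = 0 := by decide +kernel
    exact h i j hij

theorem det_gram_lamBasis :
    (Matrix.gram ℝ fun i => scaledVec (lamBasis i)).det = 12 := by
  have e : (Matrix.gram ℝ fun i => scaledVec (lamBasis i)) =
      (1 / 8 : ℝ) • (Int.castRingHom ℝ).mapMatrix
        (lamMatrix * Matrix.diagonal lamWeight * lamMatrix.transpose) := by
    ext i j
    rw [Matrix.gram_apply, inner_scaledVec,
      sum_mul_eq_sum_lamCoord (lamBasis_equal i) (lamBasis_equal j)]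
    simp only [lamMatrix, Matrix.smul_apply, RingHom.mapMatrix_apply, Matrix.map_apply,
      Matrix.mul_apply (M := _ * _), Matrix.mul_diagonal, Matrix.transpose_apply, Matrix.of_apply,
      smul_eq_mul, Int.coe_castRingHom]
    ring
  have hw : ∏ k, lamWeight k = 3 := by decide +kernel
  rw [e, Matrix.det_smul, ← RingHom.map_det, Matrix.det_mul, Matrix.det_mul, Matrix.det_transpose,
    det_lamMatrix, Matrix.det_diagonal, hw]
  -- `(2³⁴)² · 3 / 8²² = 12`.
  norm_num

theorem isLatticeOfDet_laminated22 : IsLatticeOfDet laminated22 22 12 :=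
  ⟨fun i => scaledVec (lamBasis i),
    Matrix.det_gram_ne_zero_iff_linearIndependent.1 (by rw [det_gram_lamBasis]; norm_num),
    span_scaledVec_lamBasis, det_gram_lamBasis⟩

end Laminated

/-! ### The section by `U` and the projection to `U` -/

section Projection

theorem mem_threeEqual {x : EuclideanSpace ℝ (Fin 24)} :
    x ∈ threeEqual ↔ x 0 = x 1 ∧ x 1 = x 2 := Iff.rfl

theorem sum_fin_24 {M : Type*} [AddCommMonoid M] (f : Fin 24 → M) :
    ∑ i, f i = f 0 + f 1 + f 2 + ∑ i : Fin 21, f i.succ.succ.succ := by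
  rw [Fin.sum_univ_succ, Fin.sum_univ_succ, Fin.sum_univ_succ, ← add_assoc, ← add_assoc]
  rfl

theorem succ_succ_succ_ne (i : Fin 21) :
    i.succ.succ.succ ≠ (0 : Fin 24) ∧ i.succ.succ.succ ≠ (1 : Fin 24) ∧
      i.succ.succ.succ ≠ (2 : Fin 24) := by
  revert i
  decide

theorem mem_threeEqual_orthogonal {x : EuclideanSpace ℝ (Fin 24)} :
    x ∈ threeEqualᗮ ↔ (∀ i : Fin 21, x i.succ.succ.succ = 0) ∧ x 0 + x 1 + x 2 = 0 := by
  rw [Submodule.mem_orthogonal]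
  constructor
  · intro h
    constructor
    · intro i
      have h1 : EuclideanSpace.single i.succ.succ.succ (1 : ℝ) ∈ threeEqual := by
        obtain ⟨h0, h1, h2⟩ := succ_succ_succ_ne i
        rw [mem_threeEqual]
        simp [h0.symm, h1.symm, h2.symm]
      simpa [EuclideanSpace.inner_single_left] using h _ h1
    · have h1 : EuclideanSpace.single (0 : Fin 24) (1 : ℝ) + EuclideanSpace.single 1 1 +
          EuclideanSpace.single 2 1 ∈ threeEqual := by
        rw [mem_threeEqual]
        simp
      simpa [inner_add_left, EuclideanSpace.inner_single_left] using h _ h1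
  · rintro ⟨h1, h2⟩ u hu
    obtain ⟨h01, h12⟩ := mem_threeEqual.1 hu
    rw [PiLp.inner_apply, sum_fin_24, Finset.sum_eq_zero fun i _ => by simp [h1 i]]
    simp only [RCLike.inner_apply, conj_trivial, h01, h12]
    linear_combination u 2 * h2

/-- Vectors of `V` have equal first coordinates, so the projection to `U` is determined by the
differences of the first three coordinates. -/
theorem starProjection_eq_iff {x u : EuclideanSpace ℝ (Fin 24)} :
    threeEqualᗮ.starProjection x = u ↔
      u ∈ threeEqualᗮ ∧ x 0 - x 1 = u 0 - u 1 ∧ x 1 - x 2 = u 1 - u 2 := by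
  have hV : x - u ∈ threeEqualᗮᗮ ↔ x 0 - x 1 = u 0 - u 1 ∧ x 1 - x 2 = u 1 - u 2 := by
    rw [Submodule.orthogonal_orthogonal, mem_threeEqual]
    simp only [PiLp.sub_apply]
    constructor <;> rintro ⟨h1, h2⟩ <;> constructor <;> linarith
  rw [← hV]
  constructor
  · rintro rfl
    exact ⟨Submodule.starProjection_apply_mem _ _, Submodule.sub_starProjection_mem_orthogonal _⟩
  · rintro ⟨h1, h2⟩
    exact Submodule.eq_starProjection_of_mem_orthogonal h1 h2

theorem mem_latticeProjection {u : EuclideanSpace ℝ (Fin 24)} :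
    u ∈ latticeProjection leechLattice threeEqualᗮ ↔
      ∃ a, IsLeechVec a ∧ threeEqualᗮ.starProjection (scaledVec a) = u := by
  rw [latticeProjection, Submodule.mem_map]
  constructor
  · rintro ⟨x, hx, rfl⟩
    obtain ⟨a, ha, rfl⟩ := mem_leechLattice_iff.1 hx
    exact ⟨a, ha, rfl⟩
  · rintro ⟨a, ha, rfl⟩
    exact ⟨_, scaledVec_mem_leechLattice.2 ha, rfl⟩

/-- `ℝ³` as the span of the first three coordinate vectors of `ℝ²⁴`. -/
noncomputable def startIsometry : EuclideanSpace ℝ (Fin 3) →ₗᵢ[ℝ] EuclideanSpace ℝ (Fin 24) where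
  toFun y := WithLp.toLp 2 fun i => if h : i.val < 3 then y ⟨i, h⟩ else 0
  map_add' x y := by
    ext i
    simp only [PiLp.add_apply]
    split_ifs <;> simp
  map_smul' t y := by
    ext i
    simp only [PiLp.smul_apply, RingHom.id_apply, smul_eq_mul]
    split_ifs <;> simp
  norm_map' y := by
    rw [← sq_eq_sq₀ (norm_nonneg _) (norm_nonneg _), EuclideanSpace.norm_sq_eq,
      EuclideanSpace.norm_sq_eq, sum_fin_24, Fin.sum_univ_three,
      Finset.sum_eq_zero fun i _ => ?_]
    · simp
    · change ‖(0 : ℝ)‖ ^ 2 = 0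
      simp

theorem startIsometry_zero (y : EuclideanSpace ℝ (Fin 3)) : startIsometry y 0 = y 0 := rfl

theorem startIsometry_one (y : EuclideanSpace ℝ (Fin 3)) : startIsometry y 1 = y 1 := rfl

theorem startIsometry_two (y : EuclideanSpace ℝ (Fin 3)) : startIsometry y 2 = y 2 := rfl

theorem startIsometry_succ (y : EuclideanSpace ℝ (Fin 3)) (i : Fin 21) :
    startIsometry y i.succ.succ.succ = 0 := rfl

theorem ext_fin_24 {α : Type*} {f g : Fin 24 → α} (h0 : f 0 = g 0) (h1 : f 1 = g 1)
    (h2 : f 2 = g 2) (h : ∀ i : Fin 21, f i.succ.succ.succ = g i.succ.succ.succ) (i : Fin 24) :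
    f i = g i := by
  refine Fin.cases h0 (fun i => ?_) i
  refine Fin.cases h1 (fun i => ?_) i
  exact Fin.cases h2 (fun i => h i) i

theorem startIsometry_mem_orthogonal {y : EuclideanSpace ℝ (Fin 3)} :
    startIsometry y ∈ threeEqualᗮ ↔ y 0 + y 1 + y 2 = 0 := by
  rw [mem_threeEqual_orthogonal]
  exact ⟨fun h => h.2, fun h => ⟨startIsometry_succ y, h⟩⟩

theorem sqrt_eight : √8 = 2 * √2 := by
  rw [show (8 : ℝ) = 2 ^ 2 * 2 by norm_num, Real.sqrt_mul (by norm_num),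
    Real.sqrt_sq (by norm_num)]

/-- The support has at most three points, fewer than the minimal weight `8`, so the codeword is
zero. -/
theorem IsLeechVec.exists_eq_four_mul {a : Fin 24 → ℤ} (ha : IsLeechVec a)
    (h0 : ∀ i : Fin 21, a i.succ.succ.succ = 0) : ∃ d : Fin 24 → ℤ, ∀ i, a i = 4 * d i := by
  rcases isLeechVec_iff.1 ha with ⟨b, hab, hb, -⟩ | ⟨b, hab, -⟩
  · have hc : (fun i => (b i : ZMod 2)) = 0 := by
      by_contra hne
      have h8 := eight_le_golay_weight hb hne
      have : wordWeight (fun i => (b i : ZMod 2)) ≤ ({0, 1, 2} : Finset (Fin 24)).card := by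
        refine Finset.card_le_card fun i => ?_
        refine Fin.cases (by simp) (fun i => ?_) i
        refine Fin.cases (by simp) (fun i => ?_) i
        refine Fin.cases (by simp) (fun i => ?_) i
        have := h0 i
        rw [hab] at this
        simp [show b i.succ.succ.succ = 0 by omega]
      have h3 : ({0, 1, 2} : Finset (Fin 24)).card = 3 := rfl
      omega
    have hd : ∀ i, ∃ d, b i = 2 * d := fun i => intCast_zmod_two_eq_zero.1 (congrFun hc i)
    choose d hd using hd
    exact ⟨d, fun i => by rw [hab, hd]; ring⟩
  · have := h0 0
    rw [hab] at this
    omega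

theorem latticeSection_eq :
    (latticeSection leechLattice threeEqualᗮ : Set (EuclideanSpace ℝ (Fin 24))) =
      startIsometry '' (√2 • rootLatticeA2) := by
  have h2 : √2 ≠ 0 := by positivity
  have h22 : √2 * √2 = 2 := Real.mul_self_sqrt (by norm_num)
  have h4 : ∀ n : ℝ, 4 * n / √8 = √2 * n := fun n => by
    rw [sqrt_eight, div_eq_iff (by positivity)]
    linear_combination (-2 * n) * h22
  ext x
  simp only [latticeSection, SetLike.mem_coe, Submodule.mem_inf, Submodule.restrictScalars_mem,
    Set.mem_image, Set.mem_smul_set, mem_leechLattice_iff, mem_threeEqual_orthogonal]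
  constructor
  · rintro ⟨⟨a, ha, rfl⟩, h0, hs⟩
    obtain ⟨d, hd⟩ := ha.exists_eq_four_mul fun i => by
      have := h0 i
      rw [scaledVec_apply, div_eq_zero_iff] at this
      exact_mod_cast this.resolve_right (by positivity)
    have hx : ∀ i, scaledVec a i = √2 * d i := fun i => by
      rw [scaledVec_apply, hd, ← h4]
      push_cast
      rfl
    refine ⟨_, ⟨!₂[(d 0 : ℝ), (d 1 : ℝ), (d 2 : ℝ)], ⟨?_, ?_⟩, rfl⟩, ?_⟩
    · intro i
      fin_cases i
      exacts [⟨d 0, rfl⟩, ⟨d 1, rfl⟩, ⟨d 2, rfl⟩]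
    · rw [hx, hx, hx, ← mul_add, ← mul_add] at hs
      rw [Fin.sum_univ_three]
      exact (mul_eq_zero.1 hs).resolve_left h2
    · ext i
      refine ext_fin_24 ?_ ?_ ?_ (fun i => ?_) i
      · rw [startIsometry_zero, hx]; rfl
      · rw [startIsometry_one, hx]; rfl
      · rw [startIsometry_two, hx]; rfl
      · rw [startIsometry_succ, h0]
  · rintro ⟨_, ⟨y, ⟨hy, hs⟩, rfl⟩, rfl⟩
    choose n hn using hy
    rw [Fin.sum_univ_three, hn, hn, hn] at hs
    have hs' : n 0 + n 1 + n 2 = 0 := by exact_mod_cast hs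
    set b : Fin 24 → ℤ := fun i => if h : i.val < 3 then 2 * n ⟨i, h⟩ else 0 with hb
    refine ⟨⟨fun i => 2 * b i, isLeechVec_iff.2 (Or.inl ⟨b, fun i => rfl, ?_, ?_⟩), ?_⟩,
      fun i => startIsometry_succ _ i, ?_⟩
    · convert golayCode.zero_mem using 1
      ext i
      refine intCast_zmod_two_eq_zero.2 ?_
      simp only [hb]
      split_ifs <;> simp
    · rw [sum_fin_24, Finset.sum_eq_zero fun i _ => by simp [hb]]
      change (4 : ℤ) ∣ 2 * n 0 + 2 * n 1 + 2 * n 2 + 0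
      omega
    · have hi : ∀ i : Fin 3, ((2 * (2 * n i) : ℤ) : ℝ) / √8 = √2 * y i := fun i => by
        rw [hn, ← h4]
        push_cast
        ring
      ext i
      refine ext_fin_24 (hi 0) (hi 1) (hi 2) (fun i => ?_) i
      rw [startIsometry_succ, scaledVec_apply]
      simp [hb]
    · rw [startIsometry_zero, startIsometry_one, startIsometry_two]
      simp only [PiLp.smul_apply, smul_eq_mul, hn]
      rw [← mul_add, ← mul_add, hs, mul_zero]

theorem mem_dualLattice_rootLatticeA2 {y : EuclideanSpace ℝ (Fin 3)} :
    y ∈ dualLattice rootLatticeA2 ↔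
      y 0 + y 1 + y 2 = 0 ∧ (∃ n : ℤ, y 0 - y 1 = n) ∧ ∃ n : ℤ, y 1 - y 2 = n := by
  have h1 : (!₂[1, -1, 0] : EuclideanSpace ℝ (Fin 3)) ∈ rootLatticeA2 := by
    refine ⟨fun i => ?_, by simp [Fin.sum_univ_three]⟩
    fin_cases i
    exacts [⟨1, by simp⟩, ⟨-1, by simp⟩, ⟨0, by simp⟩]
  have h2 : (!₂[0, 1, -1] : EuclideanSpace ℝ (Fin 3)) ∈ rootLatticeA2 := by
    refine ⟨fun i => ?_, by simp [Fin.sum_univ_three]⟩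
    fin_cases i
    exacts [⟨0, by simp⟩, ⟨1, by simp⟩, ⟨-1, by simp⟩]
  constructor
  · rintro ⟨hs, hi⟩
    refine ⟨?_, ?_, ?_⟩
    · clear hi
      induction hs using Submodule.span_induction with
      | mem x hx => simpa [Fin.sum_univ_three] using hx.2
      | zero => simp
      | add x y _ _ hx hy =>
        simp only [PiLp.add_apply]
        linear_combination hx + hy
      | smul t x _ hx =>
        simp only [PiLp.smul_apply, smul_eq_mul]
        linear_combination t * hx
    · obtain ⟨n, hn⟩ := hi _ h1
      refine ⟨n, ?_⟩
      rw [← hn]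
      simp [PiLp.inner_apply, Fin.sum_univ_three]
      ring
    · obtain ⟨n, hn⟩ := hi _ h2
      refine ⟨n, ?_⟩
      rw [← hn]
      simp [PiLp.inner_apply, Fin.sum_univ_three]
      ring
  · rintro ⟨hs, ⟨m, hm⟩, ⟨n, hn⟩⟩
    constructor
    · have : y = y 0 • !₂[1, -1, 0] + (y 0 + y 1) • !₂[0, 1, -1] := by
        ext i
        fin_cases i
        · simp
        · simp
        · simp
          linarith
      rw [this]
      exact add_mem (Submodule.smul_mem _ _ (Submodule.subset_span h1))
        (Submodule.smul_mem _ _ (Submodule.subset_span h2))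
    · rintro x ⟨hx, hxs⟩
      choose k hk using hx
      rw [Fin.sum_univ_three] at hxs
      -- As `∑ x = 0`, the inner product is `x 0 (y 0 - y 2) + x 1 (y 1 - y 2)`.
      refine ⟨k 0 * (m + n) + k 1 * n, ?_⟩
      simp only [PiLp.inner_apply, Fin.sum_univ_three, RCLike.inner_apply, conj_trivial]
      push_cast
      rw [← hk, ← hk, ← hm, ← hn]
      linear_combination y 2 * hxs

/-- A vector of the Leech lattice (times `√8`) beginning with `2` at position `p` and zeros at the
other ones of the first three positions. -/
def startLift (p : Fin 3) (k : Fin 24) : ℤ := if (golayMasks.getD p 0).testBit k then 2 else 0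

theorem isLeechVec_startLift (p : Fin 3) : IsLeechVec (startLift p) := by
  have h : ∀ p : Fin 3, (∀ k, startLift p k = 2 * (startLift p k / 2)) ∧
      (fun k => ((startLift p k / 2 : ℤ) : ZMod 2)) ∈ golayCode ∧
      4 ∣ ∑ k, startLift p k / 2 := by
    decide +kernel
  exact isLeechVec_iff.2 (Or.inl ⟨_, h p⟩)

theorem exists_isLeechVec_start (m n : ℤ) :
    ∃ a, IsLeechVec a ∧ a 0 - a 1 = 2 * m ∧ a 1 - a 2 = 2 * n := by
  refine ⟨(m + n) • startLift 0 + n • startLift 1, ((isLeechVec_startLift 0).zsmul _).add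
    ((isLeechVec_startLift 1).zsmul _), ?_, ?_⟩ <;>
  simp only [Pi.add_apply, Pi.smul_apply, smul_eq_mul, show startLift 0 0 = 2 from rfl,
    show startLift 0 1 = 0 from rfl, show startLift 0 2 = 0 from rfl,
    show startLift 1 0 = 0 from rfl, show startLift 1 1 = 2 from rfl,
    show startLift 1 2 = 0 from rfl] <;> ring

theorem IsLeechVec.two_dvd_sub {a : Fin 24 → ℤ} (ha : IsLeechVec a) (i j : Fin 24) :
    2 ∣ a i - a j := by
  obtain ⟨b, m, h, -⟩ := ha
  rw [h, h]
  exact ⟨b i - b j, by ring⟩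

/-- Differences of Leech coordinates are even, and by `exists_isLeechVec_start` all even pairs
occur. Divided by `√8` they are integers over `√2`, and integral differences characterize the dual
of `A₂`. -/
theorem latticeProjection_eq :
    (latticeProjection leechLattice threeEqualᗮ : Set (EuclideanSpace ℝ (Fin 24))) =
      startIsometry '' ((1 / √2) • dualLattice rootLatticeA2) := by
  have h2 : √2 ≠ 0 := by positivity
  have key : ∀ (a : Fin 24 → ℤ) (y : EuclideanSpace ℝ (Fin 3)),
      threeEqualᗮ.starProjection (scaledVec a) = startIsometry ((1 / √2) • y) ↔
        y 0 + y 1 + y 2 = 0 ∧ (a 0 - a 1 : ℝ) = 2 * (y 0 - y 1) ∧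
          (a 1 - a 2 : ℝ) = 2 * (y 1 - y 2) := by
    intro a y
    rw [starProjection_eq_iff, startIsometry_mem_orthogonal, startIsometry_zero, startIsometry_one,
      startIsometry_two]
    simp only [PiLp.smul_apply, smul_eq_mul, scaledVec_apply, sqrt_eight, ← mul_add, ← mul_sub,
      ← sub_div, mul_eq_zero, one_div, inv_eq_zero, h2, false_or]
    have e : ∀ u v : ℝ, u / (2 * √2) = (√2)⁻¹ * v ↔ u = 2 * v := fun u v => by
      field_simp
    rw [e, e]
  ext u
  simp only [SetLike.mem_coe, mem_latticeProjection, Set.mem_image, Set.mem_smul_set,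
    mem_dualLattice_rootLatticeA2]
  constructor
  · rintro ⟨a, ha, rfl⟩
    obtain ⟨m, hm⟩ := ha.two_dvd_sub 0 1
    obtain ⟨n, hn⟩ := ha.two_dvd_sub 1 2
    have hm' : (a 0 - a 1 : ℝ) = 2 * m := by exact_mod_cast hm
    have hn' : (a 1 - a 2 : ℝ) = 2 * n := by exact_mod_cast hn
    have e0 : (2 * m + n : ℝ) / 3 + (n - m) / 3 + (-m - 2 * n) / 3 = 0 := by ring
    have e1 : (2 * m + n : ℝ) / 3 - (n - m) / 3 = m := by ring
    have e2 : (n - m : ℝ) / 3 - (-m - 2 * n) / 3 = n := by ring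
    refine ⟨_, ⟨!₂[(2 * m + n : ℝ) / 3, (n - m) / 3, (-m - 2 * n) / 3],
      ⟨e0, ⟨m, e1⟩, ⟨n, e2⟩⟩, rfl⟩, ((key _ _).2 ⟨e0, ?_, ?_⟩).symm⟩
    · rw [hm']
      exact congrArg (2 * ·) e1.symm
    · rw [hn']
      exact congrArg (2 * ·) e2.symm
  · rintro ⟨_, ⟨y, ⟨hs, ⟨m, hm⟩, ⟨n, hn⟩⟩, rfl⟩, rfl⟩
    obtain ⟨a, ha, h01, h12⟩ := exists_isLeechVec_start m n
    refine ⟨a, ha, (key a y).2 ⟨hs, ?_, ?_⟩⟩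
    · rw [hm]
      exact_mod_cast h01
    · rw [hn]
      exact_mod_cast h12

theorem startVec_eq (x y z : ℝ) : startVec x y z = startIsometry ((2 / √8) • !₂[x, y, z]) := by
  ext i
  refine ext_fin_24 ?_ ?_ ?_ (fun i => ?_) i
  · rw [startIsometry_zero]; simp [startVec]
  · rw [startIsometry_one]; simp [startVec]
  · rw [startIsometry_two]; simp [startVec]
  · rw [startIsometry_succ]
    obtain ⟨h0, h1, h2⟩ := succ_succ_succ_ne i
    simp [startVec, h0, h1, h2]

theorem dist_sq_startVec (x y z x' y' z' : ℝ) : dist (startVec x y z) (startVec x' y' z') ^ 2 =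
    ((x - x') ^ 2 + (y - y') ^ 2 + (z - z') ^ 2) / 2 := by
  have h8 : √8 ^ 2 = 8 := Real.sq_sqrt (by norm_num)
  rw [startVec_eq, startVec_eq, startIsometry.isometry.dist_eq, dist_eq_norm, ← smul_sub, norm_smul,
    mul_pow, Real.norm_eq_abs, sq_abs, div_pow, h8, EuclideanSpace.norm_sq_eq, Fin.sum_univ_three]
  simp
  ring

theorem startVec_mem_latticeProjection {x y z : ℝ} {m n : ℤ} (hs : x + y + z = 0)
    (hm : x - y = m) (hn : y - z = n) :
    startVec x y z ∈ latticeProjection leechLattice threeEqualᗮ := by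
  obtain ⟨a, ha, h01, h12⟩ := exists_isLeechVec_start m n
  refine mem_latticeProjection.2 ⟨a, ha, ?_⟩
  rw [starProjection_eq_iff, startVec_eq, startIsometry_mem_orthogonal, startIsometry_zero,
    startIsometry_one, startIsometry_two]
  have h01' : (a 0 : ℝ) - a 1 = 2 * m := by exact_mod_cast h01
  have h12' : (a 1 : ℝ) - a 2 = 2 * n := by exact_mod_cast h12
  refine ⟨?_, ?_, ?_⟩
  · simp
    linear_combination (2 / √8) * hs
  · simp
    linear_combination (1 / √8) * h01' - (2 / √8) * hm
  · simp
    linear_combination (1 / √8) * h12' - (2 / √8) * hn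

theorem isEquilateralTriangle_explicitTriangle :
    IsEquilateralTriangle (latticeProjection leechLattice threeEqualᗮ) (1 / 3)
      explicitTriangle := by
  have d1 : dist (startVec 0 0 0) (startVec (2 / 3) (-1 / 3) (-1 / 3)) ^ 2 = 1 / 3 := by
    rw [dist_sq_startVec]; norm_num
  have d2 : dist (startVec 0 0 0) (startVec (1 / 3) (-2 / 3) (1 / 3)) ^ 2 = 1 / 3 := by
    rw [dist_sq_startVec]; norm_num
  have d3 : dist (startVec (2 / 3) (-1 / 3) (-1 / 3)) (startVec (1 / 3) (-2 / 3) (1 / 3)) ^ 2 =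
      1 / 3 := by
    rw [dist_sq_startVec]; norm_num
  have hne : ∀ x y : EuclideanSpace ℝ (Fin 24), dist x y ^ 2 = 1 / 3 → x ≠ y := by
    rintro x _ h rfl
    norm_num at h
  refine ⟨Set.ncard_eq_three.2 ⟨_, _, _, hne _ _ d1, hne _ _ d2, hne _ _ d3, rfl⟩, ?_, ?_⟩
  · rintro _ (rfl | rfl | rfl)
    · exact startVec_mem_latticeProjection (m := 0) (n := 0) (by norm_num) (by norm_num)
        (by norm_num)
    · exact startVec_mem_latticeProjection (m := 1) (n := 0) (by norm_num) (by norm_num)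
        (by norm_num)
    · exact startVec_mem_latticeProjection (m := 1) (n := -1) (by norm_num) (by norm_num)
        (by norm_num)
  · rintro _ (rfl | rfl | rfl) _ (rfl | rfl | rfl) h
    all_goals first
      | exact absurd rfl h
      | assumption
      | (rw [dist_comm]; assumption)

end Projection

/-! ### Minimal norms, the packing `Λ₂₂`, and the fibers of minimal vectors -/

section Triangles

theorem hasMinNorm_leechLattice : HasMinNorm leechLattice 4 := by
  constructor
  · refine ⟨scaledVec (Pi.single 3 4 + Pi.single 4 4), ?_, ?_, ?_⟩
    · rw [scaledVec_mem_leechLattice, isLeechVec_iff]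
      refine Or.inl ⟨Pi.single 3 2 + Pi.single 4 2, ?_, ?_, ?_⟩ <;> decide +kernel
    · rw [← scaledVec.map_zero]
      exact scaledVec_injective.ne (by decide +kernel)
    · have : ∑ i, (Pi.single 3 4 + Pi.single 4 4 : Fin 24 → ℤ) i ^ 2 = 32 := by decide +kernel
      rw [norm_sq_scaledVec, this]
      norm_num
  · rintro t ⟨x, hx, hx0, rfl⟩
    obtain ⟨a, ha, rfl⟩ := mem_leechLattice_iff.1 hx
    have := ha.le_sum_sq (by rintro rfl; exact hx0 scaledVec.map_zero)
    rw [norm_sq_scaledVec, le_div_iff₀ (by norm_num)]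
    exact_mod_cast this

theorem four_le_norm_sq {x : EuclideanSpace ℝ (Fin 24)} (hx : x ∈ leechLattice) (h0 : x ≠ 0) :
    4 ≤ ‖x‖ ^ 2 :=
  hasMinNorm_leechLattice.2 ⟨x, hx, h0, rfl⟩

theorem eq_zero_of_norm_sq_lt {x : EuclideanSpace ℝ (Fin 24)} (hx : x ∈ leechLattice)
    (h : ‖x‖ ^ 2 < 4) : x = 0 := by
  by_contra h0
  exact absurd (four_le_norm_sq hx h0) (not_le.2 h)

theorem hasMinNorm_laminated22 : HasMinNorm laminated22 4 := by
  constructor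
  · refine ⟨scaledVec (Pi.single 3 4 + Pi.single 4 4), ?_, ?_, ?_⟩
    · refine mem_laminated22.2 ⟨_, ?_, ?_, rfl⟩
      · rw [isLeechVec_iff]
        refine Or.inl ⟨Pi.single 3 2 + Pi.single 4 2, ?_, ?_, ?_⟩ <;> decide +kernel
      · decide +kernel
    · rw [← scaledVec.map_zero]
      exact scaledVec_injective.ne (by decide +kernel)
    · have : ∑ i, (Pi.single 3 4 + Pi.single 4 4 : Fin 24 → ℤ) i ^ 2 = 32 := by decide +kernel
      rw [norm_sq_scaledVec, this]
      norm_num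
  · rintro t ⟨x, hx, hx0, rfl⟩
    exact four_le_norm_sq (Submodule.mem_inf.1 hx).1 hx0

theorem finrank_threeEqual : Module.finrank ℝ threeEqual = 22 := by
  let φ : EuclideanSpace ℝ (Fin 24) →ₗ[ℝ] ℝ × ℝ :=
    { toFun := fun x => (x 0 - x 1, x 1 - x 2)
      map_add' := fun x y => by ext <;> simp <;> ring
      map_smul' := fun t x => by ext <;> simp <;> ring }
  have hk : LinearMap.ker φ = threeEqual := by
    ext x
    rw [LinearMap.mem_ker, mem_threeEqual]
    simp [φ, sub_eq_zero]
  have hr : LinearMap.range φ = ⊤ := by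
    rw [LinearMap.range_eq_top]
    rintro ⟨s, t⟩
    refine ⟨EuclideanSpace.single 0 (s + t) + EuclideanSpace.single 1 t, ?_⟩
    simp [φ]
  have := φ.finrank_range_add_finrank_ker
  rw [hr, hk, finrank_top, Module.finrank_prod, finrank_euclideanSpace_fin,
    Module.finrank_self] at this
  omega

instance : Nontrivial threeEqual :=
  Module.nontrivial_of_finrank_pos (R := ℝ) (by rw [finrank_threeEqual]; norm_num)

/-- The vectors of `lamBasis`, as a basis of `threeEqual`. -/
noncomputable def threeEqualBasis : Module.Basis (Fin 22) ℝ threeEqual :=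
  basisOfLinearIndependentOfCardEqFinrank
    (b := fun i => (⟨scaledVec (lamBasis i), (Submodule.mem_inf.1
      (mem_laminated22.2 ⟨_, isLeechVec_lamBasis i, lamBasis_equal i, rfl⟩)).2⟩ : threeEqual))
    (by
      refine LinearIndependent.of_comp threeEqual.subtype ?_
      refine Matrix.det_gram_ne_zero_iff_linearIndependent.1 ?_
      exact det_gram_lamBasis.trans_ne (by norm_num))
    (by rw [Fintype.card_fin, finrank_threeEqual])

theorem coe_threeEqualBasis (i : Fin 22) :
    (threeEqualBasis i : EuclideanSpace ℝ (Fin 24)) = scaledVec (lamBasis i) := by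
  simp [threeEqualBasis]

theorem mem_span_threeEqualBasis {v : threeEqual} :
    v ∈ Submodule.span ℤ (Set.range threeEqualBasis) ↔
      (v : EuclideanSpace ℝ (Fin 24)) ∈ leechLattice := by
  have h : (Submodule.span ℤ (Set.range threeEqualBasis)).map
      (threeEqual.subtype.restrictScalars ℤ) = laminated22 := by
    rw [← Submodule.span_image, ← Set.range_comp, ← span_scaledVec_lamBasis]
    congr 2
    ext1 i
    exact coe_threeEqualBasis i
  have h2 : (v : EuclideanSpace ℝ (Fin 24)) ∈ laminated22 ↔
      (v : EuclideanSpace ℝ (Fin 24)) ∈ leechLattice := by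
    rw [laminated22, latticeSection, Submodule.mem_inf]
    exact and_iff_left v.2
  rw [← h2, ← h, Submodule.mem_map]
  constructor
  · exact fun hv => ⟨v, hv, rfl⟩
  · rintro ⟨w, hw, hwv⟩
    rwa [← Subtype.ext hwv]

theorem covolume_threeEqualBasis :
    ZLattice.covolume (Submodule.span ℤ (Set.range threeEqualBasis)) = √12 := by
  rw [covolume_span_eq_sqrt_det_gram, ← det_gram_lamBasis]
  refine congrArg (fun A : Matrix (Fin 22) (Fin 22) ℝ => √A.det) (Matrix.ext fun i j => ?_)
  rw [Matrix.gram_apply, Matrix.gram_apply, Submodule.coe_inner, coe_threeEqualBasis,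
    coe_threeEqualBasis]

theorem isSpherePacking_laminated22 :
    IsSpherePacking {v : threeEqual | (v : EuclideanSpace ℝ (Fin 24)) ∈ laminated22} 1 := by
  refine ⟨one_pos, fun p hp q hq hpq => ?_⟩
  have h : (p : EuclideanSpace ℝ (Fin 24)) - q ∈ leechLattice :=
    (Submodule.mem_inf.1 (sub_mem hp hq)).1
  have h4 := four_le_norm_sq h (sub_ne_zero.2 fun h => hpq (Subtype.ext h))
  rw [Subtype.dist_eq, dist_eq_norm]
  nlinarith [norm_nonneg ((p : EuclideanSpace ℝ (Fin 24)) - q)]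

theorem hasCenterDensity_laminated22 :
    HasCenterDensity {v : threeEqual | (v : EuclideanSpace ℝ (Fin 24)) ∈ laminated22} 1
      (1 / √12) := by
  have := hasCenterDensity_of_cosets (Submodule.span ℤ (Set.range threeEqualBasis))
    isSpherePacking_laminated22 {0} (fun x => by
      simp only [Finset.mem_singleton, exists_eq_left, sub_zero]
      rw [mem_span_threeEqualBasis, Set.mem_ofPred_eq,
        laminated22, latticeSection, Submodule.mem_inf]
      exact and_iff_left x.2) (by simp)
  simpa [covolume_threeEqualBasis] using this

theorem norm_sq_orthogonalProjection (w : EuclideanSpace ℝ (Fin 24)) :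
    ‖threeEqual.orthogonalProjectionOnto w‖ ^ 2 =
      ‖w‖ ^ 2 - ‖threeEqualᗮ.starProjection w‖ ^ 2 := by
  rw [Submodule.norm_sq_eq_add_norm_sq_starProjection w threeEqual]
  rw [Submodule.starProjection_apply threeEqual, Submodule.coe_norm, add_sub_cancel_right]

theorem eq_of_projections_eq {w w' : EuclideanSpace ℝ (Fin 24)}
    (hV : threeEqual.orthogonalProjectionOnto w = threeEqual.orthogonalProjectionOnto w')
    (hU : threeEqualᗮ.starProjection w = threeEqualᗮ.starProjection w') : w = w' := by
  have h := norm_sq_orthogonalProjection (w - w')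
  rw [map_sub, map_sub, hV, hU, sub_self, sub_self, norm_zero, norm_zero] at h
  refine sub_eq_zero.1 (norm_eq_zero.1 (pow_eq_zero_iff two_ne_zero |>.1 ?_))
  linarith

theorem norm_sq_of_mem_orthogonal {u : EuclideanSpace ℝ (Fin 24)} (hu : u ∈ threeEqualᗮ) :
    ‖u‖ ^ 2 = ((u 0 - u 1) ^ 2 + (u 1 - u 2) ^ 2 + ((u 0 - u 1) + (u 1 - u 2)) ^ 2) / 3 := by
  obtain ⟨h0, hs⟩ := mem_threeEqual_orthogonal.1 hu
  rw [EuclideanSpace.norm_sq_eq, sum_fin_24, Finset.sum_eq_zero fun i _ => by simp [h0 i]]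
  simp only [Real.norm_eq_abs, sq_abs]
  rw [show u 2 = -u 0 - u 1 by linarith]
  ring

/-- The norm `1/3` leaves six possible projections, the roots of a hexagon. They prescribe the
beginning `t ± 2, t, t`, up to a cyclic shift, so `ncard_startMinVecs` applies, after negation for
the minus sign. -/
theorem ncard_leech_fiber {u : EuclideanSpace ℝ (Fin 24)}
    (hu : u ∈ latticeProjection leechLattice threeEqualᗮ) (hn : ‖u‖ ^ 2 = 1 / 3) :
    {w | w ∈ leechLattice ∧ ‖w‖ ^ 2 = 4 ∧ threeEqualᗮ.starProjection w = u}.ncard = 20736 := by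
  obtain ⟨a, ha, hau⟩ := mem_latticeProjection.1 hu
  obtain ⟨hu', h01, h12⟩ := starProjection_eq_iff.1 hau
  obtain ⟨p, hp⟩ := ha.two_dvd_sub 0 1
  obtain ⟨q, hq⟩ := ha.two_dvd_sub 1 2
  have h8 : √8 ≠ 0 := by positivity
  have h88 : √8 ^ 2 = 8 := Real.sq_sqrt (by norm_num)
  have hp' : u 0 - u 1 = 2 * p / √8 := by
    rw [← h01, scaledVec_apply, scaledVec_apply, ← sub_div]
    rw [← Int.cast_sub, hp]
    push_cast
    rfl
  have hq' : u 1 - u 2 = 2 * q / √8 := by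
    rw [← h12, scaledVec_apply, scaledVec_apply, ← sub_div]
    rw [← Int.cast_sub, hq]
    push_cast
    rfl
  rw [norm_sq_of_mem_orthogonal hu', hp', hq', ← add_div, div_pow, div_pow, div_pow, h88] at hn
  have hpq : p ^ 2 + q ^ 2 + (p + q) ^ 2 = 2 := by
    have : (p ^ 2 + q ^ 2 + (p + q) ^ 2 : ℝ) = 2 := by linarith
    exact_mod_cast this
  have e : {w | w ∈ leechLattice ∧ ‖w‖ ^ 2 = 4 ∧ threeEqualᗮ.starProjection w = u} =
      scaledVec '' {a | IsLeechVec a ∧ ∑ l, a l ^ 2 = 32 ∧ a 0 - a 1 = 2 * p ∧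
        a 1 - a 2 = 2 * q} := by
    ext w
    have hb : ∀ b, (‖scaledVec b‖ ^ 2 = 4 ∧ threeEqualᗮ.starProjection (scaledVec b) = u) ↔
        (∑ l, b l ^ 2 = 32 ∧ b 0 - b 1 = 2 * p ∧ b 1 - b 2 = 2 * q) := by
      intro b
      rw [starProjection_eq_iff, hp', hq', norm_sq_scaledVec]
      simp only [scaledVec_apply, ← sub_div, div_left_inj' h8, hu', true_and]
      rw [div_eq_iff (by norm_num), show (4 * 8 : ℝ) = (32 : ℤ) by norm_num, Int.cast_inj]
      norm_cast
    constructor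
    · rintro ⟨hw, h⟩
      obtain ⟨b, hbL, rfl⟩ := mem_leechLattice_iff.1 hw
      exact ⟨b, ⟨hbL, (hb b).1 h⟩, rfl⟩
    · rintro ⟨b, ⟨hbL, h⟩, rfl⟩
      exact ⟨scaledVec_mem_leechLattice.2 hbL, (hb b).2 h⟩
  have hneg : ∀ {i j k : Fin 24}, StartCounts i j k → i ≠ j → i ≠ k → j ≠ k →
      ((fun a : Fin 24 → ℤ => -a) '' startMinVecs i j k).ncard = 20736 := fun h h1 h2 h3 => by
    rw [Set.ncard_image_of_injective _ neg_injective, ncard_startMinVecs h h1 h2 h3]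
  have himg : ∀ (i j k : Fin 24) (a : Fin 24 → ℤ),
      a ∈ (fun a : Fin 24 → ℤ => -a) '' startMinVecs i j k ↔
        IsLeechVec a ∧ ∑ l, a l ^ 2 = 32 ∧ a j - a i = 2 ∧ a j = a k := by
    intro i j k a
    constructor
    · rintro ⟨b, ⟨h1, h2, h3, h4⟩, rfl⟩
      refine ⟨h1.neg, by simpa using h2, ?_, ?_⟩ <;> simp only [Pi.neg_apply] <;> omega
    · rintro ⟨h1, h2, h3, h4⟩
      refine ⟨-a, ⟨h1.neg, by simpa using h2, ?_, ?_⟩, neg_neg a⟩ <;>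
        simp only [Pi.neg_apply] <;> omega
  rw [e, Set.ncard_image_of_injective _ scaledVec_injective]
  have hp1 : p ≤ 1 := by nlinarith [sq_nonneg q, sq_nonneg (p + q)]
  have hp2 : -1 ≤ p := by nlinarith [sq_nonneg q, sq_nonneg (p + q)]
  have hq1 : q ≤ 1 := by nlinarith [sq_nonneg p, sq_nonneg (p + q)]
  have hq2 : -1 ≤ q := by nlinarith [sq_nonneg p, sq_nonneg (p + q)]
  have c0 := startCounts_zero
  have c1 := startCounts_one
  have c2 := startCounts_two
  have H0 := ncard_startMinVecs (i := 0) (j := 1) (k := 2) c0 (by decide) (by decide) (by decide)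
  have H1 := ncard_startMinVecs (i := 1) (j := 2) (k := 0) c1 (by decide) (by decide) (by decide)
  have H2 := ncard_startMinVecs (i := 2) (j := 0) (k := 1) c2 (by decide) (by decide) (by decide)
  have N0 := hneg (i := 0) (j := 1) (k := 2) c0 (by decide) (by decide) (by decide)
  have N1 := hneg (i := 1) (j := 2) (k := 0) c1 (by decide) (by decide) (by decide)
  have N2 := hneg (i := 2) (j := 0) (k := 1) c2 (by decide) (by decide) (by decide)
  have close : ∀ {s t : Set (Fin 24 → ℤ)}, t.ncard = 20736 → (∀ a, a ∈ s ↔ a ∈ t) →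
      s.ncard = 20736 := fun ht h => by rw [Set.ext h, ht]
  -- The pairs with `p² + q² + (p + q)² ≠ 2` are discarded; the others are `±(1, 0)`, `±(-1, 1)` and
  -- `±(0, -1)`, in the order of `H0`, `H1`, `H2`.
  interval_cases p <;> interval_cases q <;> first
    | omega
    | refine close H0 fun a => and_congr_right fun _ => and_congr_right fun _ => ?_
      omega
    | refine close H1 fun a => and_congr_right fun _ => and_congr_right fun _ => ?_
      omega
    | refine close H2 fun a => and_congr_right fun _ => and_congr_right fun _ => ?_
      omega
    | refine close N0 fun a => Iff.trans ?_ (himg _ _ _ a).symm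
      refine and_congr_right fun _ => and_congr_right fun _ => ?_
      omega
    | refine close N1 fun a => Iff.trans ?_ (himg _ _ _ a).symm
      refine and_congr_right fun _ => and_congr_right fun _ => ?_
      omega
    | refine close N2 fun a => Iff.trans ?_ (himg _ _ _ a).symm
      refine and_congr_right fun _ => and_congr_right fun _ => ?_
      omega

/-! ### The packing over a triangle -/

section Antipode

variable {S : Set (EuclideanSpace ℝ (Fin 24))}

theorem norm_sq_sub_of_triangle
    (hS : IsEquilateralTriangle (latticeProjection leechLattice threeEqualᗮ) (1 / 3) S)
    {w w' : EuclideanSpace ℝ (Fin 24)} (hw : threeEqualᗮ.starProjection w ∈ S)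
    (hw' : threeEqualᗮ.starProjection w' ∈ S)
    (hne : threeEqualᗮ.starProjection w ≠ threeEqualᗮ.starProjection w') :
    ‖threeEqualᗮ.starProjection (w - w')‖ ^ 2 = 1 / 3 := by
  rw [map_sub, ← dist_eq_norm]
  exact hS.2.2 _ hw _ hw' hne

theorem dist_sq_orthogonalProjection (w w' : EuclideanSpace ℝ (Fin 24)) :
    dist (threeEqual.orthogonalProjectionOnto w) (threeEqual.orthogonalProjectionOnto w') ^ 2 =
      ‖w - w'‖ ^ 2 - ‖threeEqualᗮ.starProjection (w - w')‖ ^ 2 := by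
  rw [dist_eq_norm, ← map_sub, norm_sq_orthogonalProjection]

theorem isSpherePacking_antipode
    (hS : IsEquilateralTriangle (latticeProjection leechLattice threeEqualᗮ) (1 / 3) S) :
    IsSpherePacking (antipode leechLattice threeEqual S) (1 / 2 * √(4 - 1 / 3)) := by
  refine ⟨by norm_num, ?_⟩
  rintro _ ⟨w, hw, hws, rfl⟩ _ ⟨w', hw', hws', rfl⟩ hne
  have h4 := four_le_norm_sq (sub_mem hw hw') (sub_ne_zero.2 fun h => hne (by rw [h]))
  rw [show 2 * (1 / 2 * √(4 - 1 / 3)) = √(4 - 1 / 3) by ring]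
  refine Real.sqrt_le_iff.2 ⟨dist_nonneg, ?_⟩
  rw [dist_sq_orthogonalProjection]
  by_cases h : threeEqualᗮ.starProjection w = threeEqualᗮ.starProjection w'
  · rw [map_sub, h, sub_self, norm_zero]
    linarith
  · rw [norm_sq_sub_of_triangle hS hws hws' h]
    linarith

theorem three_rpow_eq : (3 : ℝ) ^ (10.5 : ℝ) = 3 ^ 10 * √3 := by
  rw [show (10.5 : ℝ) = (10 : ℕ) + 1 / 2 by norm_num, Real.rpow_add (by norm_num),
    Real.rpow_natCast, Real.sqrt_eq_rpow]

theorem sqrt_twelve : √12 = 2 * √3 := by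
  rw [show (12 : ℝ) = 2 ^ 2 * 3 by norm_num, Real.sqrt_mul (by norm_num),
    Real.sqrt_sq (by norm_num)]

/-- Here `ρ² = 11/12` and `√12 = 2 √3`. -/
theorem center_density_value :
    ((3 : ℕ) : ℝ) * (1 / 2 * √(4 - 1 / 3)) ^ 22 / √12 = 11 ^ 11 / (2 ^ 23 * (3 : ℝ) ^ (10.5 : ℝ)) := by
  have h3 : (1 / 2 * √(4 - 1 / 3)) ^ 22 = (11 / 12 : ℝ) ^ 11 := by
    rw [show 22 = 2 * 11 by norm_num, pow_mul, mul_pow, Real.sq_sqrt (by norm_num)]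
    norm_num
  rw [three_rpow_eq, sqrt_twelve, h3]
  field_simp
  norm_num

theorem hasCenterDensity_antipode
    (hS : IsEquilateralTriangle (latticeProjection leechLattice threeEqualᗮ) (1 / 3) S) :
    HasCenterDensity (antipode leechLattice threeEqual S) (1 / 2 * √(4 - 1 / 3))
      (11 ^ 11 / (2 ^ 23 * (3 : ℝ) ^ (10.5 : ℝ))) := by
  classical
  have hfin : S.Finite := Set.finite_of_ncard_pos (by rw [hS.1]; norm_num)
  have hlift : ∀ s : EuclideanSpace ℝ (Fin 24), ∃ w, s ∈ S →
      w ∈ leechLattice ∧ threeEqualᗮ.starProjection w = s := by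
    intro s
    by_cases hs : s ∈ S
    · obtain ⟨a, ha, h⟩ := mem_latticeProjection.1 (hS.2.1 hs)
      exact ⟨_, fun _ => ⟨scaledVec_mem_leechLattice.2 ha, h⟩⟩
    · exact ⟨0, fun h => absurd h hs⟩
  choose l hl using hlift
  -- If the `V`-part of `l s - l t` is in the lattice, so is its `U`-part `s - t`, which has norm
  -- `1/3 < 4`.
  have hinj : ∀ s ∈ S, ∀ t ∈ S, ((threeEqual.orthogonalProjectionOnto (l s) -
      threeEqual.orthogonalProjectionOnto (l t) : threeEqual) : EuclideanSpace ℝ (Fin 24)) ∈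
        leechLattice → s = t := by
    intro s hs t ht h
    by_contra hne
    have e : threeEqualᗮ.starProjection (l s - l t) = l s - l t -
        ((threeEqual.orthogonalProjectionOnto (l s) -
          threeEqual.orthogonalProjectionOnto (l t) : threeEqual) : EuclideanSpace ℝ (Fin 24)) := by
      rw [Submodule.starProjection_orthogonal_val, ← map_sub]
      rfl
    have hn := hS.2.2 s hs t ht hne
    rw [dist_eq_norm] at hn
    have hm : s - t ∈ leechLattice := by
      rw [← (hl s hs).2, ← (hl t ht).2, ← map_sub, e]
      exact sub_mem (sub_mem (hl s hs).1 (hl t ht).1) h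
    have h0 := eq_zero_of_norm_sq_lt hm (by rw [hn]; norm_num)
    exact hne (sub_eq_zero.1 h0)
  set T : Finset threeEqual :=
    hfin.toFinset.image fun s => threeEqual.orthogonalProjectionOnto (l s) with hT
  have hcard : T.card = 3 := by
    rw [hT, Finset.card_image_of_injOn, ← Set.ncard_eq_toFinset_card _ hfin, hS.1]
    intro s hs t ht h
    refine hinj s (by simpa using hs) t (by simpa using ht) ?_
    simp only at h
    rw [h, sub_self]
    exact zero_mem _
  have key := hasCenterDensity_of_cosets (Submodule.span ℤ (Set.range threeEqualBasis))
    (isSpherePacking_antipode hS) T ?_ ?_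
  · rwa [covolume_threeEqualBasis, hcard, finrank_threeEqual, center_density_value] at key
  · intro x
    simp only [hT, Finset.mem_image, Set.Finite.mem_toFinset, exists_exists_and_eq_and,
      mem_span_threeEqualBasis]
    constructor
    · rintro ⟨w, hw, hwS, rfl⟩
      refine ⟨_, hwS, ?_⟩
      obtain ⟨h1, h2⟩ := hl _ hwS
      rw [← map_sub]
      -- Both lifts have the same projection to `U`, so their difference is in `V`.
      have : threeEqual.starProjection (w - l (threeEqualᗮ.starProjection w)) =
          w - l (threeEqualᗮ.starProjection w) := by
        have := Submodule.starProjection_orthogonal_val (K := threeEqual)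
          (w - l (threeEqualᗮ.starProjection w))
        rw [map_sub, h2, sub_self] at this
        exact (sub_eq_zero.1 this.symm).symm
      rw [← Submodule.starProjection_apply, this]
      exact sub_mem hw h1
    · rintro ⟨s, hs, h⟩
      obtain ⟨h1, h2⟩ := hl s hs
      refine ⟨l s + ((x - threeEqual.orthogonalProjectionOnto (l s) : threeEqual) :
        EuclideanSpace ℝ (Fin 24)), add_mem h1 h, ?_, ?_⟩
      · rw [map_add, h2, Submodule.starProjection_orthogonal_apply_eq_zero (Subtype.coe_prop _),
          add_zero]
        exact hs
      · rw [map_add, Submodule.orthogonalProjectionOnto_mem_subspace_eq_self]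
        abel
  · intro x hx y hy hxy
    simp only [hT, Finset.mem_image, Set.Finite.mem_toFinset] at hx hy
    obtain ⟨s, hs, rfl⟩ := hx
    obtain ⟨t, ht, rfl⟩ := hy
    rw [hinj s hs t ht (mem_span_threeEqualBasis.1 hxy)]

/-- The map `v ↦ π_V (v + w)` is a bijection from the minimal vectors with `U`-projection `s - π_U
w`: the squared distance to `π_V w` is `‖v‖² - 1/3`. -/
theorem ncard_touching_fiber
    (hS : IsEquilateralTriangle (latticeProjection leechLattice threeEqualᗮ) (1 / 3) S)
    {w : EuclideanSpace ℝ (Fin 24)} (hw : w ∈ leechLattice)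
    (hwS : threeEqualᗮ.starProjection w ∈ S) {s : EuclideanSpace ℝ (Fin 24)} (hs : s ∈ S)
    (hne : s ≠ threeEqualᗮ.starProjection w) :
    {q | ∃ w' ∈ leechLattice, threeEqualᗮ.starProjection w' = s ∧
      threeEqual.orthogonalProjectionOnto w' = q ∧
      dist (threeEqual.orthogonalProjectionOnto w) q ^ 2 = 4 - 1 / 3}.ncard = 20736 := by
  have hn : ‖s - threeEqualᗮ.starProjection w‖ ^ 2 = 1 / 3 := by
    rw [← dist_eq_norm]
    exact hS.2.2 _ hs _ hwS hne
  have hm : s - threeEqualᗮ.starProjection w ∈ latticeProjection leechLattice threeEqualᗮ :=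
    sub_mem (hS.2.1 hs) (hS.2.1 hwS)
  rw [← ncard_leech_fiber hm hn]
  symm
  refine Set.ncard_congr (fun v _ => threeEqual.orthogonalProjectionOnto (v + w)) ?_ ?_ ?_
  · rintro v ⟨hv, hv4, hvs⟩
    refine ⟨v + w, add_mem hv hw, ?_, rfl, ?_⟩
    · rw [map_add, hvs, sub_add_cancel]
    · rw [dist_comm, dist_sq_orthogonalProjection, add_sub_cancel_right, hv4, hvs, hn]
  · rintro v v' ⟨-, -, hv⟩ ⟨-, -, hv'⟩ h
    refine eq_of_projections_eq ?_ (hv.trans hv'.symm)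
    rw [map_add, map_add] at h
    exact add_right_cancel h
  · rintro _ ⟨w', hw', hs', rfl, hd⟩
    refine ⟨w' - w, ⟨sub_mem hw' hw, ?_, ?_⟩, ?_⟩
    · rw [dist_comm, dist_sq_orthogonalProjection, map_sub, hs', hn] at hd
      linarith
    · rw [map_sub, hs']
    · rw [sub_add_cancel]

theorem ncard_touching_antipode
    (hS : IsEquilateralTriangle (latticeProjection leechLattice threeEqualᗮ) (1 / 3) S)
    {p : threeEqual} (hp : p ∈ antipode leechLattice threeEqual S) :
    (touching (antipode leechLattice threeEqual S) (1 / 2 * √(4 - 1 / 3)) p).ncard = 41472 := by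
  obtain ⟨w, hw, hwS, rfl⟩ := hp
  set F : EuclideanSpace ℝ (Fin 24) → Set threeEqual := fun s =>
    {q | ∃ w' ∈ leechLattice, threeEqualᗮ.starProjection w' = s ∧
      threeEqual.orthogonalProjectionOnto w' = q ∧
      dist (threeEqual.orthogonalProjectionOnto w) q ^ 2 = 4 - 1 / 3} with hF
  obtain ⟨s, t, hst, hSst⟩ : ∃ s t, s ≠ t ∧ S \ {threeEqualᗮ.starProjection w} = {s, t} := by
    rw [← Set.ncard_eq_two, Set.ncard_sdiff_singleton_of_mem hwS, hS.1]
  have hs : s ∈ S \ {threeEqualᗮ.starProjection w} := by rw [hSst]; simp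
  have ht : t ∈ S \ {threeEqualᗮ.starProjection w} := by rw [hSst]; simp
  have hFs : (F s).ncard = 20736 := ncard_touching_fiber hS hw hwS hs.1 hs.2
  have hFt : (F t).ncard = 20736 := ncard_touching_fiber hS hw hwS ht.1 ht.2
  have hdist : ∀ q : threeEqual, dist (threeEqual.orthogonalProjectionOnto w) q =
      2 * (1 / 2 * √(4 - 1 / 3)) ↔
        dist (threeEqual.orthogonalProjectionOnto w) q ^ 2 = 4 - 1 / 3 := fun q => by
    rw [show 2 * (1 / 2 * √(4 - 1 / 3)) = √(4 - 1 / 3) by ring,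
      ← sq_eq_sq₀ dist_nonneg (Real.sqrt_nonneg _), Real.sq_sqrt (by norm_num)]
  have e : touching (antipode leechLattice threeEqual S) (1 / 2 * √(4 - 1 / 3))
      (threeEqual.orthogonalProjectionOnto w) = F s ∪ F t := by
    ext q
    constructor
    · rintro ⟨⟨w', hw', hw'S, rfl⟩, hne, hd⟩
      rw [hdist] at hd
      have hmem : threeEqualᗮ.starProjection w' ∈ S \ {threeEqualᗮ.starProjection w} := by
        refine ⟨hw'S, fun h => hne ?_⟩
        -- Over the same vertex, touching would need a lattice vector of norm `4 - 1/3`, below the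
        -- minimum.
        rw [dist_sq_orthogonalProjection, map_sub, h, sub_self, norm_zero] at hd
        rw [sub_eq_zero.1 (eq_zero_of_norm_sq_lt (sub_mem hw hw') (by linarith))]
      rw [hSst] at hmem
      rcases hmem with h | h
      · exact Or.inl ⟨w', hw', h, rfl, hd⟩
      · exact Or.inr ⟨w', hw', h, rfl, hd⟩
    · have hsub : ∀ r ∈ S, F r ⊆ touching (antipode leechLattice threeEqual S)
          (1 / 2 * √(4 - 1 / 3)) (threeEqual.orthogonalProjectionOnto w) := by
        rintro r hr _ ⟨w', hw', hw'r, rfl, hd⟩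
        refine ⟨⟨w', hw', by rwa [hw'r], rfl⟩, fun h => ?_, (hdist _).2 hd⟩
        rw [h, dist_self] at hd
        norm_num at hd
      rintro (h | h)
      · exact hsub s hs.1 h
      · exact hsub t ht.1 h
  rw [e, Set.ncard_union_eq ?_ (Set.finite_of_ncard_pos (by rw [hFs]; norm_num))
    (Set.finite_of_ncard_pos (by rw [hFt]; norm_num)), hFs, hFt]
  rw [Set.disjoint_left]
  rintro _ ⟨w₁, hw₁, h₁, rfl, -⟩ ⟨w₂, hw₂, h₂, h, -⟩
  -- A common point of both fibers would make `w₁ - w₂` a lattice vector of norm `1/3`.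
  have hd := dist_sq_orthogonalProjection w₁ w₂
  rw [h, dist_self, norm_sq_sub_of_triangle hS (h₁ ▸ hs.1) (h₂ ▸ ht.1) (by rwa [h₁, h₂])] at hd
  have h0 := eq_zero_of_norm_sq_lt (sub_mem hw₁ hw₂) (by linarith)
  exact hst (by rw [← h₁, ← h₂, sub_eq_zero.1 h0])

end Antipode

/-! ### Numerical values and the main theorem -/

theorem numerical_values :
    (0.3325 : ℝ) ≤ 11 ^ 11 / (2 ^ 23 * (3 : ℝ) ^ (10.5 : ℝ)) ∧
    11 ^ 11 / (2 ^ 23 * (3 : ℝ) ^ (10.5 : ℝ)) < (0.3326 : ℝ) ∧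
    (0.2886 : ℝ) ≤ 1 / √12 ∧ 1 / √12 < (0.2887 : ℝ) ∧
    1 / √12 < 11 ^ 11 / (2 ^ 23 * (3 : ℝ) ^ (10.5 : ℝ)) := by
  have l : 1.7320 < √3 := Real.lt_sqrt_of_sq_lt (by norm_num)
  have u : √3 < 1.7321 := (Real.sqrt_lt' (by norm_num)).2 (by norm_num)
  have a : (0.3325 : ℝ) ≤ 11 ^ 11 / (2 ^ 23 * (3 : ℝ) ^ (10.5 : ℝ)) := by
    rw [three_rpow_eq, le_div_iff₀ (by positivity)]
    linarith
  have d : 1 / √12 < (0.2887 : ℝ) := by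
    rw [sqrt_twelve, div_lt_iff₀ (by positivity)]
    linarith
  refine ⟨a, ?_, ?_, d, by linarith⟩
  · rw [three_rpow_eq, div_lt_iff₀ (by positivity)]
    linarith
  · rw [sqrt_twelve, le_div_iff₀ (by positivity)]
    linarith

end Triangles
theorem mainTheorem2 :
    -- the Leech lattice has minimal norm 4, and `V` is 22-dimensional
    HasMinNorm leechLattice 4 ∧
    Module.finrank ℝ threeEqual = 22 ∧
    -- the section `L = Λ₂₂` is a 22-dimensional lattice of determinant 12 and minimal norm 4;
    -- its packing by unit spheres has center density `1 / √12`
    IsLatticeOfDet laminated22 22 12 ∧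
    HasMinNorm laminated22 4 ∧
    IsSpherePacking {v : threeEqual | (v : EuclideanSpace ℝ (Fin 24)) ∈ laminated22} 1 ∧
    HasCenterDensity {v : threeEqual | (v : EuclideanSpace ℝ (Fin 24)) ∈ laminated22} 1
      (1 / √12) ∧
    -- `K = √2 A₂` and `M = (1 / √2) A₂*`
    (∃ f : EuclideanSpace ℝ (Fin 3) →ₗᵢ[ℝ] EuclideanSpace ℝ (Fin 24),
      (latticeSection leechLattice threeEqualᗮ : Set (EuclideanSpace ℝ (Fin 24))) =
        f '' (√2 • rootLatticeA2) ∧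
      (latticeProjection leechLattice threeEqualᗮ : Set (EuclideanSpace ℝ (Fin 24))) =
        f '' ((1 / √2) • dualLattice rootLatticeA2)) ∧
    -- equilateral triangles with `β = 1/3` exist in `M`
    IsEquilateralTriangle (latticeProjection leechLattice threeEqualᗮ) (1 / 3)
      explicitTriangle ∧
    -- the packing `V₂₂ = 𝒜(S)` obtained from any such triangle `S`
    (∀ S : Set (EuclideanSpace ℝ (Fin 24)),
      IsEquilateralTriangle (latticeProjection leechLattice threeEqualᗮ) (1 / 3) S →
      IsSpherePacking (antipode leechLattice threeEqual S) (1 / 2 * √(4 - 1 / 3)) ∧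
      HasCenterDensity (antipode leechLattice threeEqual S) (1 / 2 * √(4 - 1 / 3))
        (11 ^ 11 / (2 ^ 23 * (3 : ℝ) ^ (10.5 : ℝ))) ∧
      ∀ p ∈ antipode leechLattice threeEqual S,
        (touching (antipode leechLattice threeEqual S) (1 / 2 * √(4 - 1 / 3)) p).ncard =
          41472) ∧
    -- the numerical values; `V₂₂` is denser than `Λ₂₂`
    (0.3325 : ℝ) ≤ 11 ^ 11 / (2 ^ 23 * (3 : ℝ) ^ (10.5 : ℝ)) ∧
    11 ^ 11 / (2 ^ 23 * (3 : ℝ) ^ (10.5 : ℝ)) < (0.3326 : ℝ) ∧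
    (0.2886 : ℝ) ≤ 1 / √12 ∧ 1 / √12 < (0.2887 : ℝ) ∧
    1 / √12 < 11 ^ 11 / (2 ^ 23 * (3 : ℝ) ^ (10.5 : ℝ)) := by
  exact ⟨hasMinNorm_leechLattice, finrank_threeEqual, isLatticeOfDet_laminated22,
    hasMinNorm_laminated22, isSpherePacking_laminated22, hasCenterDensity_laminated22,
    ⟨startIsometry, latticeSection_eq, latticeProjection_eq⟩,
    isEquilateralTriangle_explicitTriangle,
    fun S hS => ⟨isSpherePacking_antipode hS, hasCenterDensity_antipode hS,
      fun _ hp => ncard_touching_antipode hS hp⟩, numerical_values⟩
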